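/- Let $X$ be a complex Banach space and let $B(X)$ be the Banach algebra of all bounded linear operators on $X$. Let $\mathcal A \neq \{0\}$ be a norm-closed (not necessarily unital) subalgebra of $B(X)$ such that every operator $T \in \mathcal A$ is quasinilpotent (its spectral radius is $0$) and polynomially compact (there is a non-zero complex polynomial $p$ such that $p(T)$ is a compact operator). Let $\mathcal A' = \{T \in B(X) : TS = ST \text{ for every } S \in \mathcal A\}$ be the commutant of $\mathcal A$. Then $\mathcal A$ has a non-trivial hyperinvariant subspace, that is, there is a closed linear subspace $M$ of $X$ with $\{0\} \neq M \neq X$ such that $TM \subseteq M$ for every $T \in \mathcal A \cup \mathcal A'$. Equivalently, the hyperalgebra $\mathcal H(\mathcal A)$, i.e. the subalgebra of $B(X)$ generated by $\mathcal A \cup \mathcal A'$, is reducible: there is a closed linear subspace $M$ of $X$ with $\{0\} \neq M \neq X$ such that $TM \subseteq M$ for every $T \in \mathcal H(\mathcal A)$. -/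

import Mathlib

namespace HyperinvariantSubspace

variable {E : Type*} [NormedAddCommGroup E] [NormedSpace ℂ E]

/-- An operator is quasinilpotent if its spectral radius is zero. -/
def IsQuasinilpotent (T : E →L[ℂ] E) : Prop :=
  spectralRadius ℂ T = 0

/-- An operator `T` is polynomially compact if `p(T)` is compact for some non-zero complex
polynomial `p`. -/
def IsPolynomiallyCompact (T : E →L[ℂ] E) : Prop :=
  ∃ p : Polynomial ℂ, p ≠ 0 ∧ IsCompactOperator (Polynomial.aeval T p : E →L[ℂ] E)

/-- `M` is an invariant (closed) subspace for every operator in the set `S`. -/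
def IsInvariantSubspace (S : Set (E →L[ℂ] E)) (M : Submodule ℂ E) : Prop :=
  IsClosed (M : Set E) ∧ ∀ T ∈ S, ∀ x ∈ M, T x ∈ M

/-- `M` is a hyperinvariant (closed) subspace of the set `S`: it is invariant for every operator
in `S` and for every operator in the commutant of `S`. -/
def IsHyperinvariantSubspace (S : Set (E →L[ℂ] E)) (M : Submodule ℂ E) : Prop :=
  IsInvariantSubspace S M ∧ IsInvariantSubspace (Set.centralizer S) M

/-- A subspace is non-trivial if it is neither `{0}` nor the whole space. -/
def IsNontrivialSubspace (M : Submodule ℂ E) : Prop :=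
  M ≠ ⊥ ∧ M ≠ ⊤

/-- A set of operators is reducible if it has a non-trivial invariant closed subspace. -/
def IsReducible (S : Set (E →L[ℂ] E)) : Prop :=
  ∃ M : Submodule ℂ E, IsNontrivialSubspace M ∧ IsInvariantSubspace S M

/-- The hyperalgebra of `S`: the algebra generated by `S` and its commutant. The commutant contains
the identity operator, so this algebra is automatically unital. -/
def hyperalgebra (S : Set (E →L[ℂ] E)) : NonUnitalSubalgebra ℂ (E →L[ℂ] E) :=
  NonUnitalAlgebra.adjoin ℂ (S ∪ Set.centralizer S)

end HyperinvariantSubspace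

/-!
The theorem rests on two facts. The first is Turovskii's theorem, in the form
`growthOn_top_of_quasinilpotent`: if all products of members of a finite family of compact operators
are quasinilpotent, then the joint spectral radius of the family is zero, that is, products of
length `n` are `O(r ^ n)` for every `r > 0`. The second is Hilden's version of Lomonosov's argument,
`exists_finite_return`, which needs no fixed point theorem: if a set `H` of operators moves every
non-zero vector to a dense set and `T ≠ 0` is compact, then finitely many `h ∈ H` suffice to send
every point of some ball `B`, which stays away from `0`, back into `B` by some `h * T`.

Suppose first that the algebra `A` contains a compact operator `k ≠ 0`
(`isReducible_of_isCompactOperator`). If the hyperalgebra were irreducible, Hilden's argument would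
give arbitrarily long products of operators `h * k`, with `h` from a finite subset of the
hyperalgebra, that keep some vector in `B`. But `h * k` is a finite sum of operators `c * k'` where
`c` commutes with `A` and `k' ∈ A` is compact. The coefficients `c` can be collected in front of
such a product, so Turovskii's theorem for the finitely many `k'` makes the product tend to zero.

Otherwise every operator in `A` is nilpotent, because a quasinilpotent polynomially compact operator
has a compact power. Baire's theorem bounds the nilpotency index on an open subset of `A`, and
differentiating `(a + t x) ^ n = 0` yields `u ≠ 0` in `A` with `u * x * u = 0` for all `x ∈ A`
(`exists_sandwich_eq_zero`). Then `u` kills the closed subspace generated by `u y` under the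
hyperalgebra, so this subspace is proper, and it is non-zero when `u y ≠ 0`.

For Turovskii's theorem, two applications of Zorn's lemma reduce to an irreducible family, on a
quotient of closed invariant subspaces; compactness makes the operators small modulo suitable
members of the chains, and growth on a block triangular family is governed by its diagonal blocks
(`GrowthOn.of_mod`). An irreducible family is scaled to joint spectral radius `1`. Its words are then
bounded, since otherwise Hilden's argument applied to a limit of normalized words would produce
exponential growth (`exists_norm_word_le_of_growthOn`). If they are bounded but do not become small,
orbits return near themselves, so that a limit of words fixes a non-zero vector, and an idempotent
`p ≠ 0` is a limit of words (`exists_length_norm_word_le`). This is impossible for quasinilpotent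
words (`HasSuperexponentialDecay.lt_norm_sub`).
-/

namespace HyperinvariantSubspace

open Filter Topology

/-! ### Words in a family of operators and their growth -/

section Words

variable {ι E : Type*} [NormedAddCommGroup E] [NormedSpace ℂ E]

/-- The product of the members of the family `m` indexed by the letters of the word `l`. The last
letter acts first. -/
def word (m : ι → E →L[ℂ] E) (l : List ι) : E →L[ℂ] E := (l.map m).prod

@[simp] lemma word_nil (m : ι → E →L[ℂ] E) : word m [] = 1 := rfl

@[simp] lemma word_cons (m : ι → E →L[ℂ] E) (i : ι) (l : List ι) :
    word m (i :: l) = m i * word m l := by simp [word]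

@[simp] lemma word_append (m : ι → E →L[ℂ] E) (l l' : List ι) :
    word m (l ++ l') = word m l * word m l' := by simp [word]

lemma word_smul (m : ι → E →L[ℂ] E) (c : ℂ) (l : List ι) :
    word (fun i => c • m i) l = c ^ l.length • word m l := by
  induction l with
  | nil => simp
  | cons i l ih => simp [ih, pow_succ', smul_smul, mul_comm]

lemma word_mapsTo {m : ι → E →L[ℂ] E} {Y : Submodule ℂ E} (hY : ∀ i, ∀ x ∈ Y, m i x ∈ Y)
    (l : List ι) {x : E} (hx : x ∈ Y) : word m l x ∈ Y := by
  induction l with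
  | nil => simpa
  | cons i l ih => simpa using hY i _ ih

/-- A semiconjugacy between two families of operators carries over to words. -/
lemma word_semiconj {F : Type*} [NormedAddCommGroup F] [NormedSpace ℂ F] {m : ι → E →L[ℂ] E}
    {m' : ι → F →L[ℂ] F} {π : E → F} (h : ∀ i x, π (m i x) = m' i (π x)) (l : List ι) (x : E) :
    π (word m l x) = word m' l (π x) := by
  induction l with
  | nil => simp
  | cons i l ih => simp [h, ih]

/-- On the subspace `Y`, words of length `n` grow at most like `r ^ n`: this is slightly
stronger than saying that the restriction of `m` to `Y` has joint spectral radius at most `r`. -/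
def GrowthOn (m : ι → E →L[ℂ] E) (Y : Submodule ℂ E) (r : ℝ) : Prop :=
  ∃ C : ℝ, ∀ l : List ι, ∀ y ∈ Y, ‖word m l y‖ ≤ C * r ^ l.length * ‖y‖

lemma GrowthOn.exists_nonneg {m : ι → E →L[ℂ] E} {Y : Submodule ℂ E} {r : ℝ} (hr : 0 ≤ r)
    (h : GrowthOn m Y r) :
    ∃ C : ℝ, 0 ≤ C ∧ ∀ l : List ι, ∀ y ∈ Y, ‖word m l y‖ ≤ C * r ^ l.length * ‖y‖ := by
  obtain ⟨C, hC⟩ := h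
  exact ⟨max C 0, le_max_right _ _, fun l y hy =>
    (hC l y hy).trans (by gcongr; exact le_max_left _ _)⟩

lemma growthOn_top_iff {m : ι → E →L[ℂ] E} {r : ℝ} (hr : 0 ≤ r) :
    GrowthOn m ⊤ r ↔ ∃ C : ℝ, 0 ≤ C ∧ ∀ l : List ι, ‖word m l‖ ≤ C * r ^ l.length := by
  constructor
  · intro h
    obtain ⟨C, hC0, hC⟩ := h.exists_nonneg hr
    exact ⟨C, hC0, fun l => ContinuousLinearMap.opNorm_le_bound _ (by positivity)
      fun x => hC l x trivial⟩
  · rintro ⟨C, hC0, hC⟩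
    exact ⟨C, fun l y _ => (word m l).le_of_opNorm_le (hC l) y⟩

/-- The set of vectors whose orbit under words grows at most like `t * r ^ n`. The least such `t`
is an extended norm of `x` with respect to which every member of the family has norm at most `r`. -/
def orbitBall (m : ι → E →L[ℂ] E) (r t : ℝ) : Set E :=
  {x | ∀ l : List ι, ‖word m l x‖ ≤ t * r ^ l.length}

lemma norm_le_of_mem_orbitBall {m : ι → E →L[ℂ] E} {r t : ℝ} {x : E} (hx : x ∈ orbitBall m r t) :
    ‖x‖ ≤ t := by simpa using hx []

lemma orbitBall_mono {m : ι → E →L[ℂ] E} {r s t : ℝ} (hr : 0 ≤ r) (h : s ≤ t) :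
    orbitBall m r s ⊆ orbitBall m r t :=
  fun _ hx l => (hx l).trans (by gcongr)

lemma word_mem_orbitBall {m : ι → E →L[ℂ] E} {r t : ℝ} {x : E} (hx : x ∈ orbitBall m r t)
    (l : List ι) : word m l x ∈ orbitBall m r (t * r ^ l.length) := by
  intro l'
  have := hx (l' ++ l)
  rw [word_append] at this
  refine this.trans_eq ?_
  rw [List.length_append]; ring

lemma add_mem_orbitBall {m : ι → E →L[ℂ] E} {r s t : ℝ} {x y : E} (hx : x ∈ orbitBall m r s)
    (hy : y ∈ orbitBall m r t) : x + y ∈ orbitBall m r (s + t) := by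
  intro l
  rw [map_add, add_mul]
  exact (norm_add_le _ _).trans (add_le_add (hx l) (hy l))

lemma apply_mem_orbitBall_of_commute {m : ι → E →L[ℂ] E} {r t : ℝ} {x : E}
    (hx : x ∈ orbitBall m r t) {c : E →L[ℂ] E} (hc : ∀ i, Commute c (m i)) :
    c x ∈ orbitBall m r (‖c‖ * t) := by
  intro l
  have h : Commute c (word m l) :=
    Commute.list_prod_right _ _ (by simp only [List.mem_map]; rintro _ ⟨i, -, rfl⟩; exact hc i)
  have h2 : word m l (c x) = c (word m l x) := by
    have := congrArg (fun T : E →L[ℂ] E => T x) h.eq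
    exact this.symm
  rw [h2, mul_assoc]
  exact c.le_opNorm_of_le (hx l)

lemma smul_mem_orbitBall {m : ι → E →L[ℂ] E} {r t : ℝ} {x : E}
    (hx : x ∈ orbitBall m r t) (c : ℂ) : c • x ∈ orbitBall m r (‖c‖ * t) := by
  intro l
  rw [map_smul, norm_smul, mul_assoc]
  gcongr
  exact hx l

end Words

/-! ### Multiplication by compact operators and Hilden's argument -/

section Compactness

variable {E : Type*} [NormedAddCommGroup E] [NormedSpace ℂ E]

/-- Vala's theorem: two-sided multiplication by compact operators is a compact map. -/
lemma totallyBounded_compact_mul_compact {a b : E →L[ℂ] E} (ha : IsCompactOperator a)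
    (hb : IsCompactOperator b) (R : ℝ) :
    TotallyBounded {c : E →L[ℂ] E | ∃ x : E →L[ℂ] E, ‖x‖ ≤ R ∧ c = a * x * b} := by
  refine Metric.totallyBounded_of_finite_discretization fun ε hε => ?_
  set D : ℝ := ‖a‖ * |R| with hD
  have hD0 : 0 ≤ D := by positivity
  set δ : ℝ := ε / (4 * (D + 1)) with hδ
  have hδ0 : 0 < δ := by positivity
  have hDδ : D * δ ≤ ε / 4 := by
    rw [hδ, ← mul_div_assoc, div_le_div_iff₀ (by positivity) (by positivity)]
    nlinarith
  -- A finite subset of the unit ball whose image under `b` is a net for the image of the ball.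
  obtain ⟨t, ht, htfin, htcov⟩ := Set.exists_subset_image_finite_and.1
    (Metric.finite_approx_of_totallyBounded ((hb.isCompact_closure_image_closedBall
      (f := (b : E →ₗ[ℂ] E)) 1).totallyBounded.subset subset_closure) δ hδ0)
  -- A finite net for the image under `a` of a ball containing all `x (b z)`.
  obtain ⟨u, hufin, hucov⟩ := Metric.totallyBounded_iff.1
    ((ha.isCompact_closure_image_closedBall (f := (a : E →ₗ[ℂ] E))
      (|R| * ‖b‖)).totallyBounded.subset subset_closure) (ε / 8) (by positivity)
  have key : ∀ c : {c : E →L[ℂ] E | ∃ x : E →L[ℂ] E, ‖x‖ ≤ R ∧ c = a * x * b}, ∀ z : t,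
      ∃ v : u, dist (c.1 z) v < ε / 8 := by
    rintro ⟨_, x, hx, rfl⟩ z
    have hz : ‖(z : E)‖ ≤ 1 := by simpa using ht z.2
    have : a (x (b z)) ∈ (a : E →ₗ[ℂ] E) '' Metric.closedBall 0 (|R| * ‖b‖) := by
      refine ⟨x (b z), ?_, rfl⟩
      rw [mem_closedBall_zero_iff]
      calc ‖x (b z)‖ ≤ |R| * ‖b z‖ := x.le_of_opNorm_le (hx.trans (le_abs_self R)) _
        _ ≤ |R| * ‖b‖ := by gcongr; exact b.unit_le_opNorm _ hz
    obtain ⟨v, hv, hd⟩ := Set.mem_iUnion₂.1 (hucov this)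
    exact ⟨⟨v, hv⟩, hd⟩
  choose F hF using key
  have := htfin.fintype
  have := hufin.fintype
  classical
  refine ⟨t → u, inferInstance, F, fun c c' hcc => ?_⟩
  have hball : ∀ c : {c : E →L[ℂ] E | ∃ x : E →L[ℂ] E, ‖x‖ ≤ R ∧ c = a * x * b}, ∀ w z : E,
      ‖b w - b z‖ ≤ δ → ‖c.1 w - c.1 z‖ ≤ ε / 4 := by
    rintro ⟨_, x, hx, rfl⟩ w z h
    have e : (a * x * b) w - (a * x * b) z = a (x (b w - b z)) := by simp
    calc ‖(a * x * b) w - (a * x * b) z‖ ≤ ‖a‖ * (|R| * δ) := by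
          rw [e]
          exact a.le_opNorm_of_le (x.le_of_opNorm_le_of_le (hx.trans (le_abs_self R)) h)
      _ ≤ ε / 4 := by rw [← mul_assoc]; exact hDδ
  rw [dist_eq_norm]
  refine (ContinuousLinearMap.opNorm_le_of_unit_norm (𝕜 := ℂ) (C := 3 * ε / 4) (by positivity)
    fun w hw => ?_).trans_lt (by linarith)
  obtain ⟨_, ⟨z, hz, rfl⟩, hd⟩ := Set.mem_iUnion₂.1
    (htcov ⟨w, by simp [hw], rfl⟩)
  have hd' : ‖b w - b z‖ ≤ δ := by rw [← dist_eq_norm]; exact hd.le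
  have h1 := hball c w z hd'
  have h2 := hball c' w z hd'
  have h3 : dist (c.1 z) (c'.1 z) < ε / 4 := by
    have h4 := hF c ⟨z, hz⟩
    have h5 := hF c' ⟨z, hz⟩
    rw [← hcc] at h5
    have := dist_triangle_right (c.1 z) (c'.1 z) (F c ⟨z, hz⟩)
    simp only at h4 h5
    linarith
  rw [dist_eq_norm] at h3
  calc ‖(c.1 - c'.1) w‖ = ‖(c.1 w - c.1 z) + (c.1 z - c'.1 z) - (c'.1 w - c'.1 z)‖ := by
        rw [sub_apply]; congr 1; abel
    _ ≤ ‖c.1 w - c.1 z‖ + ‖c.1 z - c'.1 z‖ + ‖c'.1 w - c'.1 z‖ :=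
        (norm_sub_le _ _).trans (by gcongr; exact norm_add_le _ _)
    _ ≤ 3 * ε / 4 := by linarith

/-- Hilden's form of Lomonosov's argument: if the operators in `H` move every non-zero vector to a
dense set, then finitely many of them bring the image under a compact operator `T ≠ 0` of a
suitable ball back into this ball, and they also do so for all `T'` near `T`. -/
lemma exists_finite_return {T : E →L[ℂ] E} (hT : IsCompactOperator T) (hT0 : T ≠ 0)
    {H : Set (E →L[ℂ] E)} (hH : ∀ y : E, y ≠ 0 → Dense {z | ∃ h ∈ H, h y = z}) :
    ∃ x₀ : E, (∀ y ∈ Metric.closedBall x₀ 1, 1 ≤ ‖y‖) ∧ ∃ F : Finset (E →L[ℂ] E), ↑F ⊆ H ∧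
      ∃ δ > 0, ∀ T' : E →L[ℂ] E, ‖T' - T‖ ≤ δ → ∀ y ∈ Metric.closedBall x₀ 1,
        ∃ h ∈ F, h (T' y) ∈ Metric.closedBall x₀ 1 := by
  have hTn : 0 < ‖T‖ := norm_pos_iff.2 hT0
  obtain ⟨x₀, hx₀⟩ : ∃ x₀, 2 * ‖T‖ < ‖T x₀‖ := by
    by_contra! h
    obtain ⟨x, hx⟩ : ∃ x, T x ≠ 0 := by
      by_contra! h; exact hT0 (ContinuousLinearMap.ext h)
    obtain ⟨n, hn⟩ := exists_nat_gt (2 * ‖T‖ / ‖T x‖)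
    have := h ((n : ℂ) • x)
    rw [map_smul, norm_smul, Complex.norm_natCast] at this
    rw [div_lt_iff₀ (norm_pos_iff.2 hx)] at hn
    linarith
  have hx₀' : 2 ≤ ‖x₀‖ := by
    have := hx₀.le.trans (T.le_opNorm x₀)
    nlinarith
  have hball : ∀ y ∈ Metric.closedBall x₀ 1, ‖x₀ - y‖ ≤ 1 := fun y hy => by
    rw [Metric.mem_closedBall', dist_eq_norm] at hy; exact hy
  have hTy : ∀ y ∈ Metric.closedBall x₀ 1, ‖T‖ ≤ ‖T y‖ := fun y hy => by
    have h1 := T.le_opNorm_of_le (hball y hy)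
    rw [map_sub] at h1
    have := norm_sub_norm_le (T x₀) (T y)
    linarith
  refine ⟨x₀, fun y hy => ?_, ?_⟩
  · have := norm_sub_norm_le x₀ y
    linarith [hball y hy]
  set Q : Set E := closure (T '' Metric.closedBall x₀ 1)
  have hQ : IsCompact Q := hT.isCompact_closure_image_of_bounded (f := (T : E →ₗ[ℂ] E))
    Metric.isBounded_closedBall
  have hQ0 : ∀ z ∈ Q, z ≠ 0 := by
    have : Q ⊆ {z | ‖T‖ ≤ ‖z‖} := closure_minimal (by rintro _ ⟨y, hy, rfl⟩; exact hTy y hy)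
      (isClosed_le continuous_const continuous_norm)
    rintro z hz rfl
    have := this hz
    simp only [Set.mem_ofPred_eq, norm_zero] at this
    linarith
  obtain ⟨s, hs⟩ := hQ.elim_finite_subcover (fun h : H => {z | dist (h.1 z) x₀ < 1 / 2})
    (fun h => isOpen_lt (by fun_prop) continuous_const) (fun z hz => by
      obtain ⟨_, ⟨h, hh, rfl⟩, hd⟩ := (hH z (hQ0 z hz)).exists_dist_lt x₀ (half_pos one_pos)
      rw [dist_comm] at hd
      exact Set.mem_iUnion.2 ⟨⟨h, hh⟩, hd⟩)
  classical
  refine ⟨s.image Subtype.val, by intro h; simp +contextual, ?_⟩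
  set S : ℝ := ∑ h ∈ s, ‖h.1‖
  have hS0 : 0 ≤ S := by positivity
  refine ⟨1 / (2 * (S + 1) * (‖x₀‖ + 1)), by positivity, fun T' hT' y hy => ?_⟩
  obtain ⟨h, hh, hd⟩ := Set.mem_iUnion₂.1 (hs (subset_closure ⟨y, hy, rfl⟩ : T y ∈ Q))
  refine ⟨h.1, Finset.mem_image_of_mem _ hh, ?_⟩
  have hyn : ‖y‖ ≤ ‖x₀‖ + 1 := by
    have := norm_sub_norm_le y x₀
    rw [norm_sub_rev] at this
    linarith [hball y hy]
  have h1 : ‖h.1‖ ≤ S :=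
    Finset.single_le_sum (f := fun h : H => ‖h.1‖) (fun _ _ => norm_nonneg _) hh
  have h2 : ‖h.1 ((T' - T) y)‖ ≤ 1 / 2 := by
    calc ‖h.1 ((T' - T) y)‖ ≤ (S + 1) * (1 / (2 * (S + 1) * (‖x₀‖ + 1)) * (‖x₀‖ + 1)) :=
          h.1.le_of_opNorm_le_of_le (h1.trans (by linarith))
            ((T' - T).le_of_opNorm_le_of_le hT' hyn)
      _ = 1 / 2 := by field_simp
  rw [Metric.mem_closedBall]
  have e : h.1 (T' y) - x₀ = h.1 ((T' - T) y) + (h.1 (T y) - x₀) := by simp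
  rw [dist_eq_norm, e]
  have hd' : ‖h.1 (T y) - x₀‖ < 1 / 2 := by rw [← dist_eq_norm]; exact hd
  linarith [norm_add_le (h.1 ((T' - T) y)) (h.1 (T y) - x₀)]

end Compactness

/-! ### Quasinilpotent elements and idempotents -/

section Quasinilpotent

variable {A : Type*} [NormedRing A]

/-- The powers of `v` decay faster than every geometric sequence. Over `ℂ` this says that the
spectral radius of `v` is zero; unlike the spectral radius, the bound passes at once to restrictions
and quotients. -/
def HasSuperexponentialDecay (v : A) : Prop :=
  ∀ ε > 0, ∃ C : ℝ, ∀ n : ℕ, ‖v ^ n‖ ≤ C * ε ^ n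

variable [NormedAlgebra ℂ A] [CompleteSpace A]

lemma hasSuperexponentialDecay_of_spectralRadius_eq_zero {v : A} (hv : spectralRadius ℂ v = 0) :
    HasSuperexponentialDecay v := by
  intro ε hε
  have h := spectrum.pow_norm_pow_one_div_tendsto_nhds_spectralRadius v
  rw [hv] at h
  have h2 := (h.eventually (gt_mem_nhds (ENNReal.ofReal_pos.2 hε))).and (eventually_gt_atTop 0)
  obtain ⟨N, hN⟩ := eventually_atTop.1 h2
  refine ⟨1 + ∑ k ∈ Finset.range N, ‖v ^ k‖ / ε ^ k, fun n => ?_⟩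
  have hS : ∀ k ∈ Finset.range N, 0 ≤ ‖v ^ k‖ / ε ^ k := fun k _ => by positivity
  rcases lt_or_ge n N with hn | hn
  · have := Finset.single_le_sum hS (Finset.mem_range.2 hn)
    rw [div_le_iff₀ (by positivity)] at this
    refine this.trans ?_
    gcongr
    linarith
  · obtain ⟨h3, h4⟩ := hN n hn
    have h5 := (ENNReal.ofReal_lt_ofReal_iff hε).1 h3
    have h6 : ‖v ^ n‖ ≤ ε ^ n := by
      have := pow_le_pow_left₀ (by positivity) h5.le n
      rwa [one_div, Real.rpow_inv_natCast_pow (norm_nonneg _) h4.ne'] at this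
    have := Finset.sum_nonneg hS
    have h7 : (0 : ℝ) < ε ^ n := by positivity
    nlinarith

lemma HasSuperexponentialDecay.isUnit_one_sub_smul {v : A} (hv : HasSuperexponentialDecay v)
    (z : ℂ) : IsUnit (1 - z • v) := by
  obtain ⟨C, hC⟩ := hv (1 / (2 * (‖z‖ + 1))) (by positivity)
  obtain ⟨n, hn⟩ := exists_pow_lt_of_lt_one (show (0 : ℝ) < 1 / (|C| + 1) by positivity)
    (show (1 / 2 : ℝ) < 1 by norm_num)
  have h1 : ‖(z • v) ^ n‖ < 1 := by
    have e : (‖z‖ * (1 / (2 * (‖z‖ + 1)))) ≤ 1 / 2 := by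
      rw [mul_one_div, div_le_div_iff₀ (by positivity) (by norm_num)]
      linarith
    calc ‖(z • v) ^ n‖ ≤ ‖z‖ ^ n * (C * (1 / (2 * (‖z‖ + 1))) ^ n) := by
          rw [smul_pow, norm_smul, norm_pow]
          gcongr
          exact hC n
      _ ≤ ‖z‖ ^ n * (|C| * (1 / (2 * (‖z‖ + 1))) ^ n) := by gcongr; exact le_abs_self C
      _ = |C| * (‖z‖ * (1 / (2 * (‖z‖ + 1)))) ^ n := by rw [mul_pow]; ring
      _ ≤ |C| * (1 / 2) ^ n := by gcongr
      _ ≤ |C| * (1 / (|C| + 1)) := by gcongr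
      _ < 1 := by rw [mul_one_div, div_lt_one (by positivity)]; linarith
  have h2 := isUnit_one_sub_of_norm_lt_one h1
  rw [← mul_neg_geom_sum] at h2
  refine ((Commute.isUnit_mul_iff ?_).1 h2).1
  exact (Commute.sum_right _ _ _ fun i _ =>
    ((Commute.one_left _).sub_left (Commute.refl _)).pow_right i)

/-- An idempotent `p ≠ 0` is not a limit of quasinilpotent elements `v`: the resolvent
`(1 - z v)⁻¹` is entire, so its value at `z = 1` is controlled by its values on the circle
`|z - 1| = 1 / 2`, where it is close to `(1 - z p)⁻¹`. -/
lemma HasSuperexponentialDecay.lt_norm_sub {v p : A} (hv : HasSuperexponentialDecay v)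
    (hp : p * p = p) (hp0 : p ≠ 0) : 1 / (3 * (‖(1 : A)‖ + 3 * ‖p‖)) < ‖v - p‖ := by
  by_contra! hle
  have hpn : 0 < ‖p‖ := norm_pos_iff.2 hp0
  set K : ℝ := ‖(1 : A)‖ + 3 * ‖p‖
  have hK : 0 < K := by positivity
  rw [le_div_iff₀ (by positivity)] at hle
  have hW : ∀ z : ℂ, Ring.inverse (1 - z • v) * (1 - z • v) = 1 := fun z =>
    Ring.inverse_mul_cancel _ (hv.isUnit_one_sub_smul z)
  have hd : DifferentiableOn ℂ (fun z : ℂ => Ring.inverse (1 - z • v)) Set.univ := by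
    intro z _
    refine DifferentiableAt.differentiableWithinAt ?_
    exact (differentiableAt_inverse (𝕜 := ℂ) (hv.isUnit_one_sub_smul z)).comp z
      (f := fun z : ℂ => 1 - z • v) (by fun_prop)
  have hbound : ∀ z ∈ frontier (Metric.ball (1 : ℂ) (1 / 2)),
      ‖Ring.inverse (1 - z • v)‖ ≤ 2 * K := by
    intro z hz
    rw [frontier_ball _ (by norm_num), mem_sphere_iff_norm] at hz
    have hz1 : 1 - z ≠ 0 := by
      intro h
      rw [sub_eq_zero] at h
      rw [← h] at hz
      norm_num at hz
    have hz2 : ‖z‖ ≤ 3 / 2 := by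
      have := norm_add_le (z - 1) 1
      rw [hz, sub_add_cancel, norm_one] at this
      linarith
    set W := Ring.inverse (1 - z • v)
    set R : A := 1 + (z / (1 - z)) • p with hR
    have hpR : (1 - z • p) * R = 1 := by
      have : (1 - z • p) * R = 1 + (z / (1 - z) - z - z * (z / (1 - z))) • p := by
        rw [hR, sub_mul, mul_add, mul_add, smul_mul_smul_comm, hp]
        simp only [one_mul, mul_one, sub_smul]
        abel
      rw [this, show z / (1 - z) - z - z * (z / (1 - z)) = 0 by field_simp; ring]
      simp
    have hRn : ‖R‖ ≤ K := by
      refine (norm_add_le _ _).trans ?_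
      rw [norm_smul, norm_div, norm_sub_rev 1 z, hz]
      have : ‖z‖ / (1 / 2) ≤ 3 := by linarith
      change _ ≤ ‖(1 : A)‖ + 3 * ‖p‖
      gcongr
    have hWR : W = R + W * (z • (v - p)) * R := by
      have : W = W * ((1 - z • p) * R) := by rw [hpR, mul_one]
      calc W = W * ((1 - z • p) * R) := this
        _ = (W * (1 - z • v)) * R + W * (z • (v - p)) * R := by
            rw [smul_sub]; noncomm_ring
        _ = _ := by rw [hW, one_mul]
    have h1 : ‖W‖ ≤ K + ‖W‖ * (3 / 2 * ‖v - p‖) * K := by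
      conv_lhs => rw [hWR]
      refine (norm_add_le _ _).trans (add_le_add hRn ?_)
      refine (norm_mul_le _ _).trans ?_
      gcongr
      refine (norm_mul_le _ _).trans ?_
      rw [norm_smul]
      gcongr
    have h2 : ‖W‖ * (3 / 2 * ‖v - p‖) * K ≤ ‖W‖ * (1 / 2) := by
      rw [mul_assoc]
      gcongr
      linarith
    linarith
  have h1 := Complex.norm_le_of_forall_mem_frontier_norm_le Metric.isBounded_ball
    (hd.mono (Set.subset_univ _)).diffContOnCl hbound
    (subset_closure (Metric.mem_ball_self (by norm_num)) : (1 : ℂ) ∈ _)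
  have h2 := hW 1
  simp only [one_smul] at h1 h2
  have h3 : p = Ring.inverse (1 - v) * (p - v) * p := by
    have : (p - v) * p = (1 - v) * p := by rw [sub_mul, sub_mul, hp, one_mul]
    rw [mul_assoc, this, ← mul_assoc, h2, one_mul]
  have h4 : ‖p‖ ≤ 2 * K * ‖v - p‖ * ‖p‖ := by
    conv_lhs => rw [h3]
    refine (norm_mul_le _ _).trans ?_
    gcongr
    refine (norm_mul_le _ _).trans ?_
    rw [norm_sub_rev p v]
    gcongr
  nlinarith

end Quasinilpotent

/-! ### Bounded words -/

section Bounded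

variable {ι E : Type*} [NormedAddCommGroup E] [NormedSpace ℂ E]

lemma exists_eq_cons_append_singleton {l : List ι} (hl : 2 ≤ l.length) :
    ∃ i l' j, l = i :: (l' ++ [j]) := by
  match l, hl with
  | i :: k :: l, _ =>
    exact ⟨i, (k :: l).dropLast, (k :: l).getLast (by simp), by
      rw [List.dropLast_append_getLast]⟩

/-- A compact set containing all products `m i * x * m j` with `‖x‖ ≤ R`. -/
lemma exists_isCompact_sandwich [CompleteSpace E] [Finite ι] {m : ι → E →L[ℂ] E}
    (hm : ∀ i, IsCompactOperator (m i)) (R : ℝ) :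
    ∃ V : Set (E →L[ℂ] E), IsCompact V ∧
      ∀ i j, ∀ x : E →L[ℂ] E, ‖x‖ ≤ R → m i * x * m j ∈ V := by
  refine ⟨⋃ q : ι × ι, closure {c | ∃ x : E →L[ℂ] E, ‖x‖ ≤ R ∧ c = m q.1 * x * m q.2},
    isCompact_iUnion fun q => ?_, fun i j x hx => ?_⟩
  · exact (totallyBounded_compact_mul_compact (hm _) (hm _) R).closure.isCompact_of_isClosed
      isClosed_closure
  · exact Set.mem_iUnion.2 ⟨(i, j), subset_closure ⟨x, hx, rfl⟩⟩

/-- The orbit of a vector under a long word stays in a compact set, so it nearly returns to a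
previous point. -/
lemma exists_almost_fixed [Finite ι] {m : ι → E →L[ℂ] E}
    (hm : ∀ i, IsCompactOperator (m i)) {C : ℝ} (hC : ∀ l, ‖word m l‖ ≤ C)
    (hlong : ∀ n, ∃ l : List ι, l.length = n ∧ 1 / 2 < ‖word m l‖) :
    ∃ Q : Set E, IsCompact Q ∧ ∀ ε > 0, ∃ y ∈ Q, 1 / 2 ≤ C * ‖y‖ ∧ ∃ l : List ι, 2 ≤ l.length ∧
      ‖word m l y - y‖ ≤ ε := by
  have hC0 : 0 ≤ C := (norm_nonneg _).trans (hC [])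
  refine ⟨⋃ i, closure (m i '' Metric.closedBall 0 C), isCompact_iUnion fun i =>
    (hm i).isCompact_closure_image_closedBall (f := (m i : E →ₗ[ℂ] E)) C, fun ε hε => ?_⟩
  set Q : Set E := ⋃ i, closure (m i '' Metric.closedBall 0 C) with hQdef
  have hQ : IsCompact Q := isCompact_iUnion fun i =>
    (hm i).isCompact_closure_image_closedBall (f := (m i : E →ₗ[ℂ] E)) C
  obtain ⟨t, htfin, ht⟩ := Metric.totallyBounded_iff.1 hQ.totallyBounded (ε / 2) (half_pos hε)
  set N := htfin.toFinset.card
  obtain ⟨l, hl, hlw⟩ := hlong (2 * N + 1)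
  obtain ⟨x, hx1, hx⟩ := (word m l).exists_lt_apply_of_lt_opNorm hlw
  set u : ℕ → E := fun k => word m (l.drop (2 * k)) x with hu
  have huQ : ∀ k ∈ Finset.range (N + 1), u k ∈ Q := by
    intro k hk
    rw [Finset.mem_range] at hk
    obtain ⟨i, l', hl'⟩ := List.exists_cons_of_length_pos
      (show 0 < (l.drop (2 * k)).length by rw [List.length_drop]; omega)
    refine Set.mem_iUnion.2 ⟨i, subset_closure ⟨word m l' x, ?_, ?_⟩⟩
    · rw [mem_closedBall_zero_iff]
      exact (((word m l').le_of_opNorm_le_of_le (hC l') hx1.le)).trans (by simp)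
    · simp [hu, hl']
  have huC : ∀ k, 1 / 2 ≤ C * ‖u k‖ := by
    intro k
    have : word m l x = word m (l.take (2 * k)) (u k) := by
      rw [hu, ← mul_apply_eq_comp, ← word_append, List.take_append_drop]
    rw [this] at hx
    exact hx.le.trans ((word m _).le_of_opNorm_le (hC _) _)
  have hnear : ∀ k ∈ Finset.range (N + 1), ∃ z ∈ htfin.toFinset, dist (u k) z < ε / 2 := by
    intro k hk
    obtain ⟨z, hz, hd⟩ := Set.mem_iUnion₂.1 (ht (huQ k hk))
    exact ⟨z, by simpa using hz, hd⟩
  choose! f hf hfd using hnear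
  obtain ⟨a, ha, b, hb, hab, hfab⟩ := Finset.exists_ne_map_eq_of_card_lt_of_maps_to
    (by simp [N] : htfin.toFinset.card < (Finset.range (N + 1)).card) hf
  wlog hlt : a < b generalizing a b
  · exact this b hb a ha hab.symm hfab.symm (by omega)
  refine ⟨u b, huQ b hb, huC b, (l.drop (2 * a)).take (2 * b - 2 * a), ?_, ?_⟩
  · rw [Finset.mem_range] at ha hb
    rw [List.length_take, List.length_drop]
    omega
  · have : word m ((l.drop (2 * a)).take (2 * b - 2 * a)) (u b) = u a := by
      have h2 : l.drop (2 * b) = (l.drop (2 * a)).drop (2 * b - 2 * a) := by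
        rw [List.drop_drop]; congr 1; omega
      rw [hu]
      dsimp only
      rw [h2, ← mul_apply_eq_comp, ← word_append, List.take_append_drop]
    rw [this, ← dist_eq_norm]
    have h1 := hfd a ha
    have h2 := hfd b hb
    rw [hfab] at h1
    exact (dist_triangle_right _ _ _).trans (by linarith)

/-- If all words in finitely many compact operators are quasinilpotent and bounded, then words of
some fixed length are small. Otherwise a limit of words fixes a non-zero vector, the powers of this
limit accumulate at a non-zero idempotent, and this idempotent is a limit of words. -/
lemma exists_length_norm_word_le [CompleteSpace E] [Finite ι] {m : ι → E →L[ℂ] E}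
    (hm : ∀ i, IsCompactOperator (m i))
    (hq : ∀ l : List ι, l ≠ [] → HasSuperexponentialDecay (word m l))
    {C : ℝ} (hC : ∀ l, ‖word m l‖ ≤ C) :
    ∃ n, ∀ l : List ι, l.length = n → ‖word m l‖ ≤ 1 / 2 := by
  by_contra! hlong
  obtain ⟨Q, hQ, hfix⟩ := exists_almost_fixed hm hC hlong
  obtain ⟨V, hV, hVmem⟩ := exists_isCompact_sandwich hm C
  choose y hyQ hyC l hl hly using fun n : ℕ => hfix (1 / ((n : ℝ) + 1)) (by positivity)
  have hlV : ∀ n, word m (l n) ∈ V := fun n => by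
    obtain ⟨i, l', j, h⟩ := exists_eq_cons_append_singleton (hl n)
    rw [h]
    simpa [mul_assoc] using hVmem i j _ (hC l')
  obtain ⟨⟨y₀, T⟩, -, φ, hφ, hlim⟩ := (hQ.prod hV).tendsto_subseq
    (x := fun n => (y n, word m (l n))) fun n => ⟨hyQ n, hlV n⟩
  have hylim : Tendsto (fun n => y (φ n)) atTop (𝓝 y₀) := (continuous_fst.tendsto _).comp hlim
  have hTlim : Tendsto (fun n => word m (l (φ n))) atTop (𝓝 T) :=
    (continuous_snd.tendsto _).comp hlim
  have hy0 : y₀ ≠ 0 := by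
    rintro rfl
    have : 1 / 2 ≤ C * ‖(0 : E)‖ := ge_of_tendsto (hylim.norm.const_mul C)
      (Eventually.of_forall fun n => hyC (φ n))
    norm_num at this
  have hTy : T y₀ = y₀ := by
    have h1 : Tendsto (fun n => word m (l (φ n)) (y (φ n)) - y (φ n)) atTop (𝓝 (T y₀ - y₀)) :=
      ((isBoundedBilinearMap_apply.continuous.tendsto (T, y₀)).comp
        (hTlim.prodMk_nhds hylim)).sub hylim
    have h2 : Tendsto (fun n => word m (l (φ n)) (y (φ n)) - y (φ n)) atTop (𝓝 0) :=
      squeeze_zero_norm (fun n => hly (φ n))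
        (tendsto_one_div_add_atTop_nhds_zero_nat.comp hφ.tendsto_atTop)
    exact sub_eq_zero.1 (tendsto_nhds_unique h1 h2)
  let W : Subsemigroup (E →L[ℂ] E) :=
    { carrier := {v | ∃ l : List ι, l ≠ [] ∧ v = word m l}
      mul_mem' := by
        rintro _ _ ⟨l, hl, rfl⟩ ⟨l', hl', rfl⟩
        exact ⟨l ++ l', by simp [hl], (word_append m l l').symm⟩ }
  have hTW : T ∈ W.topologicalClosure :=
    mem_closure_of_tendsto hTlim (Eventually.of_forall fun n =>
      ⟨l (φ n), by intro h; simpa [h] using hl (φ n), rfl⟩)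
  have hWC : ∀ v ∈ W.topologicalClosure, ‖v‖ ≤ C :=
    fun v hv => closure_minimal (t := {v | ‖v‖ ≤ C}) (by rintro _ ⟨l, -, rfl⟩; exact hC l)
      (isClosed_le continuous_norm continuous_const) hv
  have hTc : IsCompactOperator T := by
    refine isCompactOperator_of_tendsto hTlim (Eventually.of_forall fun n => ?_)
    obtain ⟨i, l', h⟩ := List.exists_cons_of_length_pos
      (by have := hl (φ n); omega : 0 < (l (φ n)).length)
    rw [h, word_cons]
    exact (hm i).comp_clm _
  have hpow : ∀ n : ℕ, T ^ (n + 1) ∈ W.topologicalClosure := fun n => by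
    induction n with
    | zero => simpa using hTW
    | succ n ih => rw [pow_succ]; exact mul_mem ih hTW
  -- The powers from the third on are of the form `T * x * T`, so that they are precompact.
  set s : Set (E →L[ℂ] E) := closure (Set.range fun n : ℕ => T ^ (n + 3))
  have hs : IsCompact s := by
    refine ((totallyBounded_compact_mul_compact hTc hTc C).subset ?_).closure.isCompact_of_isClosed
      isClosed_closure
    rintro _ ⟨n, rfl⟩
    exact ⟨T ^ (n + 1), hWC _ (hpow n), by dsimp only; rw [← pow_succ', ← pow_succ]⟩
  have hsmul : ∀ x ∈ s, ∀ y ∈ s, x * y ∈ s := fun x hx y hy => by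
    refine map_mem_closure₂ continuous_mul hx hy ?_
    rintro _ ⟨n, rfl⟩ _ ⟨k, rfl⟩
    exact ⟨n + 3 + k, by dsimp only; rw [← pow_add]; congr 1⟩
  obtain ⟨p, hps, hp⟩ := exists_idempotent_in_compact_subsemigroup
    (fun r => continuous_id.mul continuous_const) s ⟨_, subset_closure ⟨0, rfl⟩⟩ hs hsmul
  have hpW : p ∈ closure {v | ∃ l : List ι, l ≠ [] ∧ v = word m l} :=
    closure_minimal (by rintro _ ⟨n, rfl⟩; exact hpow (n + 2)) isClosed_closure hps
  have hpy : p y₀ = y₀ := by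
    refine closure_minimal (t := {p : E →L[ℂ] E | p y₀ = y₀}) ?_
      (isClosed_eq (by fun_prop) continuous_const) hps
    rintro _ ⟨n, rfl⟩
    change (T ^ (n + 3)) y₀ = y₀
    induction n + 3 with
    | zero => simp
    | succ n ih => rw [pow_succ, mul_apply_eq_comp, hTy, ih]
  have hp0 : p ≠ 0 := by
    rintro rfl
    exact hy0 (by simpa using hpy.symm)
  obtain ⟨_, ⟨l, hl, rfl⟩, hd⟩ := Metric.mem_closure_iff.1 hpW
    (1 / (3 * (‖(1 : E →L[ℂ] E)‖ + 3 * ‖p‖)))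
    (by have := norm_pos_iff.2 hp0; positivity)
  rw [dist_comm, dist_eq_norm] at hd
  exact lt_asymm hd ((hq l hl).lt_norm_sub hp hp0)

end Bounded

/-! ### Irreducible families -/

section Irreducible

variable {ι E : Type*} [NormedAddCommGroup E] [NormedSpace ℂ E]

/-- A ball keeping away from `0` contains no sequence along which the orbit growth is halved. -/
lemma not_orbitBall_halving {m : ι → E →L[ℂ] E} {r t : ℝ} {x₀ : E}
    (hx₀ : ∀ y ∈ Metric.closedBall x₀ 1, 1 ≤ ‖y‖) (ht : x₀ ∈ orbitBall m r t)
    (hhalf : ∀ s : ℝ, 0 ≤ s → ∀ y ∈ Metric.closedBall x₀ 1, y ∈ orbitBall m r s →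
      ∃ y' ∈ Metric.closedBall x₀ 1, y' ∈ orbitBall m r (s / 2)) : False := by
  have ht0 : 0 ≤ t := (norm_nonneg _).trans (norm_le_of_mem_orbitBall ht)
  have key : ∀ n : ℕ, ∃ y ∈ Metric.closedBall x₀ 1, y ∈ orbitBall m r (t * (1 / 2) ^ n) := by
    intro n
    induction n with
    | zero => exact ⟨x₀, Metric.mem_closedBall_self zero_le_one, by simpa using ht⟩
    | succ n ih =>
      obtain ⟨y, hy, hyt⟩ := ih
      obtain ⟨y', hy', hyt'⟩ := hhalf _ (by positivity) y hy hyt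
      exact ⟨y', hy', by rwa [pow_succ, ← mul_assoc, mul_one_div]⟩
  have hlim : Tendsto (fun n : ℕ => t * (1 / 2 : ℝ) ^ n) atTop (𝓝 0) := by
    simpa using (tendsto_pow_atTop_nhds_zero_of_lt_one (r := (1 / 2 : ℝ)) (by norm_num)
      (by norm_num)).const_mul t
  obtain ⟨n, hn⟩ := (hlim.eventually (gt_mem_nhds one_pos)).exists
  obtain ⟨y, hy, hyt⟩ := key n
  exact absurd ((hx₀ y hy).trans (norm_le_of_mem_orbitBall hyt)) hn.not_ge

/-- Linear combinations of words enlarge orbit growth by bounded factors, uniformly over a finite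
set of such combinations and over `r` near `1`. -/
lemma exists_mapsTo_orbitBall_of_mem_span (m : ι → E →L[ℂ] E) (F : Finset (E →L[ℂ] E))
    (hF : ↑F ⊆ (Submodule.span ℂ (Set.range (word m)) : Set (E →L[ℂ] E))) :
    ∃ K : ℝ, 0 ≤ K ∧ ∃ D : ℕ, ∀ h ∈ F, ∀ r : ℝ, 1 ≤ r → ∀ t, 0 ≤ t → ∀ x ∈ orbitBall m r t,
      h x ∈ orbitBall m r (K * r ^ D * t) := by
  have hmono : ∀ {K K' r t : ℝ} {D D' : ℕ}, 0 ≤ K' → K ≤ K' → D ≤ D' → 1 ≤ r → 0 ≤ t →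
      orbitBall m r (K * r ^ D * t) ⊆ orbitBall m r (K' * r ^ D' * t) := by
    intro K K' r t D D' hK' hK hD hr ht
    refine orbitBall_mono (zero_le_one.trans hr) ?_
    gcongr
  have single : ∀ h ∈ Submodule.span ℂ (Set.range (word m)), ∃ K : ℝ, 0 ≤ K ∧ ∃ D : ℕ,
      ∀ r : ℝ, 1 ≤ r → ∀ t, 0 ≤ t → ∀ x ∈ orbitBall m r t,
        h x ∈ orbitBall m r (K * r ^ D * t) := by
    intro h hh
    induction hh using Submodule.span_induction with
    | mem h hh =>
      obtain ⟨l, rfl⟩ := hh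
      refine ⟨1, zero_le_one, l.length, fun r hr t ht x hx => ?_⟩
      have := word_mem_orbitBall hx l
      rwa [one_mul, mul_comm]
    | zero =>
      refine ⟨0, le_rfl, 0, fun r hr t ht x hx l => ?_⟩
      simp
    | add h h' _ _ ih ih' =>
      obtain ⟨K, hK, D, H⟩ := ih
      obtain ⟨K', hK', D', H'⟩ := ih'
      refine ⟨K + K', by positivity, max D D', fun r hr t ht x hx => ?_⟩
      have h1 := hmono hK le_rfl (le_max_left D D') hr ht (H r hr t ht x hx)
      have h2 := hmono hK' le_rfl (le_max_right D D') hr ht (H' r hr t ht x hx)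
      rw [add_mul, add_mul]
      exact add_mem_orbitBall h1 h2
    | smul c h _ ih =>
      obtain ⟨K, hK, D, H⟩ := ih
      refine ⟨‖c‖ * K, by positivity, D, fun r hr t ht x hx => ?_⟩
      have := smul_mem_orbitBall (H r hr t ht x hx) c
      rwa [← mul_assoc, ← mul_assoc] at this
  choose! K hK D H using single
  refine ⟨∑ h ∈ F, K h, Finset.sum_nonneg fun h hh => hK h (hF hh), ∑ h ∈ F, D h,
    fun h hh r hr t ht x hx => ?_⟩
  exact hmono (Finset.sum_nonneg fun h hh => hK h (hF hh))
    (Finset.single_le_sum (f := K) (fun h hh => hK h (hF hh)) hh)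
    (Finset.single_le_sum (f := D) (fun _ _ => Nat.zero_le _) hh) hr ht (H h (hF hh) r hr t ht x hx)

/-- The family `m` has no closed invariant subspaces besides `⊥` and `⊤`. -/
def IsIrreducibleFamily (m : ι → E →L[ℂ] E) : Prop :=
  ∀ Y : Submodule ℂ E, IsClosed (Y : Set E) → (∀ i, ∀ x ∈ Y, m i x ∈ Y) → Y = ⊥ ∨ Y = ⊤

lemma IsIrreducibleFamily.dense {m : ι → E →L[ℂ] E} (hirr : IsIrreducibleFamily m) {y : E}
    (hy : y ≠ 0) : Dense {z | ∃ h ∈ (Submodule.span ℂ (Set.range (word m)) : Set (E →L[ℂ] E)),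
      h y = z} := by
  set Y : Submodule ℂ E := (Submodule.span ℂ (Set.range (word m))).map
    (ContinuousLinearMap.apply ℂ E y : (E →L[ℂ] E) →ₗ[ℂ] E) with hYdef
  have hmY : ∀ i, ∀ x ∈ Y, m i x ∈ Y := by
    rintro i _ ⟨h, hh, rfl⟩
    refine ⟨m i * h, ?_, rfl⟩
    induction hh using Submodule.span_induction with
    | mem h hh =>
      obtain ⟨l, rfl⟩ := hh
      exact Submodule.subset_span ⟨i :: l, word_cons m i l⟩
    | zero => simp
    | add h h' _ _ ih ih' => rw [mul_add]; exact add_mem ih ih'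
    | smul c h _ ih => rw [mul_smul_comm]; exact Submodule.smul_mem _ _ ih
  have hyY : y ∈ Y := ⟨1, Submodule.subset_span ⟨[], rfl⟩, rfl⟩
  rcases hirr Y.topologicalClosure Y.isClosed_topologicalClosure (fun i x hx =>
    map_mem_closure (m i).continuous hx (hmY i)) with h | h
  · exact absurd ((Submodule.mem_bot ℂ).1 (h ▸ Y.le_topologicalClosure hyY)) hy
  · exact (Submodule.dense_iff_topologicalClosure_eq_top).2 h

/-- Among the words up to some length, one of large norm has maximal norm. -/
lemma exists_leading_word [Finite ι] {m : ι → E →L[ℂ] E}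
    (hunb : ∀ C, ∃ l : List ι, C < ‖word m l‖) (C : ℝ) :
    ∃ l : List ι, 2 ≤ l.length ∧ C < ‖word m l‖ ∧
      ∀ l' : List ι, l'.length ≤ l.length → ‖word m l'‖ ≤ ‖word m l‖ := by
  obtain ⟨B, hB⟩ := ((List.finite_length_le ι 1).image fun l => ‖word m l‖).bddAbove
  obtain ⟨l₀, hl₀⟩ := hunb (max B C)
  obtain ⟨l, hl, hmax⟩ := Set.exists_max_image {l : List ι | l.length ≤ l₀.length}
    (fun l => ‖word m l‖) (List.finite_length_le ι _) ⟨l₀, by simp⟩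
  have h0 := hl₀.trans_le (hmax l₀ (by simp))
  refine ⟨l, ?_, (le_max_right _ _).trans_lt h0, fun l' hl' => hmax l' (hl'.trans hl)⟩
  by_contra! h
  have := hB ⟨l, (by simp only [Set.mem_ofPred_eq]; omega), rfl⟩
  exact absurd ((le_max_left _ _).trans_lt h0) (not_lt.2 this)

/-- Turovskii's dichotomy: an irreducible finite family of compact operators whose words grow
subexponentially has bounded words. Otherwise the normalized leading words `a / ‖a‖` accumulate at
some `T ≠ 0`. Hilden's argument for `T` applies to a nearby `a / ‖a‖` and yields products of words in
which each factor `a` contributes a factor comparable to `‖a‖`, hence exponential growth. -/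
lemma exists_norm_word_le_of_growthOn [CompleteSpace E] [Finite ι] {m : ι → E →L[ℂ] E}
    (hm : ∀ i, IsCompactOperator (m i)) (hirr : IsIrreducibleFamily m)
    (hgrow : ∀ r > 1, GrowthOn m ⊤ r) : ∃ C, ∀ l, ‖word m l‖ ≤ C := by
  by_contra! hunb
  obtain ⟨V, hV, hVmem⟩ := exists_isCompact_sandwich hm 1
  choose l hl2 hln hlmax using fun n : ℕ => exists_leading_word hunb n
  set a : ℕ → E →L[ℂ] E := fun n => word m (l n) with ha
  have hapos : ∀ n, 0 < ‖a n‖ := fun n => (Nat.cast_nonneg n).trans_lt (hln n)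
  set S : ℕ → E →L[ℂ] E := fun n => ((‖a n‖⁻¹ : ℝ) : ℂ) • a n with hS
  have hSV : ∀ n, S n ∈ V := fun n => by
    obtain ⟨i, l', j, h⟩ := exists_eq_cons_append_singleton (hl2 n)
    have e : S n = m i * (((‖a n‖⁻¹ : ℝ) : ℂ) • word m l') * m j := by
      rw [hS]
      simp only [ha, h, word_cons, word_append, word_nil, mul_one, mul_smul_comm, smul_mul_assoc,
        mul_assoc]
    rw [e]
    refine hVmem i j _ ?_
    rw [norm_smul, Complex.norm_real, norm_inv, norm_norm]
    refine inv_mul_le_one_of_le₀ (hlmax n l' ?_) (norm_nonneg _)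
    rw [h]; simp; omega
  obtain ⟨T, -, φ, hφ, hlim⟩ := hV.tendsto_subseq hSV
  have hSn : ∀ n, ‖S n‖ = 1 := fun n => by
    rw [hS, norm_smul, Complex.norm_real, norm_inv, norm_norm, inv_mul_cancel₀ (hapos n).ne']
  have hT0 : T ≠ 0 := by
    rintro rfl
    have := tendsto_nhds_unique hlim.norm
      (by simp [hSn] : Tendsto (fun n => ‖(S ∘ φ) n‖) atTop (𝓝 1))
    simp at this
  have hTc : IsCompactOperator T := by
    refine isCompactOperator_of_tendsto hlim (Eventually.of_forall fun n => ?_)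
    obtain ⟨i, l', h⟩ := List.exists_cons_of_length_pos
      (by have := hl2 (φ n); omega : 0 < (l (φ n)).length)
    simp only [Function.comp, hS, ha]
    rw [h, word_cons]
    exact ((hm i).comp_clm _).smul _
  obtain ⟨x₀, hx₀, F, hF, δ, hδ, hret⟩ := exists_finite_return hTc hT0
    (H := (Submodule.span ℂ (Set.range (word m)) : Set (E →L[ℂ] E))) (fun y hy => hirr.dense hy)
  obtain ⟨K, hK, D, hKD⟩ := exists_mapsTo_orbitBall_of_mem_span m F hF
  obtain ⟨n, hn1, hn2⟩ := ((Metric.tendsto_nhds.1 hlim δ hδ).and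
    (hφ.tendsto_atTop.eventually (eventually_ge_atTop ⌈4 * K⌉₊))).exists
  rw [dist_eq_norm] at hn1
  set k := φ n
  have hak : 4 * K ≤ ‖a k‖ := (Nat.le_ceil _).trans ((Nat.cast_le.2 hn2).trans (hln k).le)
  -- Now that `a k` is fixed, `r > 1` is chosen so that its length does not matter.
  obtain ⟨r, hr2, hr1⟩ : ∃ r : ℝ, r ^ (D + (l k).length) < 2 ∧ 1 < r := by
    have h1 : Tendsto (fun r : ℝ => r ^ (D + (l k).length)) (𝓝[>] 1) (𝓝 1) :=
      ((continuous_pow _).tendsto' 1 1 (one_pow _)).mono_left nhdsWithin_le_nhds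
    exact ((h1.eventually (gt_mem_nhds one_lt_two)).and self_mem_nhdsWithin).exists
  have hr0 : 0 ≤ r := by linarith
  obtain ⟨C, hC0, hC⟩ := (growthOn_top_iff hr0).1 (hgrow r hr1)
  refine not_orbitBall_halving (m := m) (r := r) (t := C * ‖x₀‖) hx₀ (fun w => ?_)
    fun s hs y hy hys => ?_
  · exact ((word m w).le_of_opNorm_le (hC w) x₀).trans_eq (by ring)
  · obtain ⟨h, hhF, hh⟩ := hret (S k) hn1.le y hy
    refine ⟨_, hh, ?_⟩
    have h1 : S k y ∈ orbitBall m r (‖((‖a k‖⁻¹ : ℝ) : ℂ)‖ * (s * r ^ (l k).length)) :=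
      smul_mem_orbitBall (word_mem_orbitBall hys (l k)) _
    have h2 := hKD h hhF r hr1.le _ (by positivity) _ h1
    refine orbitBall_mono hr0 ?_ h2
    rw [Complex.norm_real, norm_inv, norm_norm]
    calc K * r ^ D * (‖a k‖⁻¹ * (s * r ^ (l k).length))
        = s * (K * ‖a k‖⁻¹) * r ^ (D + (l k).length) := by rw [pow_add]; ring
      _ ≤ s * (1 / 4) * 2 := by
          gcongr
          rw [← div_eq_mul_inv, div_le_iff₀ (hapos k)]
          linarith
      _ = s / 2 := by ring

lemma growthOn_of_norm_word_le_pow {m : ι → E →L[ℂ] E} {C q : ℝ} {n : ℕ} (hn : n ≠ 0)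
    (hq0 : 0 < q) (hq1 : q ≤ 1) (hC : ∀ l, ‖word m l‖ ≤ C)
    (h : ∀ l : List ι, l.length = n → ‖word m l‖ ≤ q ^ n) : GrowthOn m ⊤ q := by
  have hC0 : 0 ≤ C := (norm_nonneg _).trans (hC [])
  refine (growthOn_top_iff hq0.le).2 ⟨C / q ^ n, by positivity, fun l => ?_⟩
  induction hk : l.length using Nat.strong_induction_on generalizing l with
  | _ k ih =>
    rcases lt_or_ge k n with hkn | hkn
    · refine (hC l).trans ?_
      rw [div_mul_eq_mul_div, le_div_iff₀ (by positivity)]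
      gcongr C * ?_
      exact pow_le_pow_of_le_one hq0.le hq1 hkn.le
    · have h1 := ih (k - n) (by omega) (l.drop n) (by rw [List.length_drop, hk])
      have h2 := h (l.take n) (by rw [List.length_take]; omega)
      calc ‖word m l‖ = ‖word m (l.take n) * word m (l.drop n)‖ := by
            rw [← word_append, List.take_append_drop]
        _ ≤ q ^ n * (C / q ^ n * q ^ (k - n)) :=
            (norm_mul_le _ _).trans (mul_le_mul h2 h1 (norm_nonneg _) (by positivity))
        _ = C / q ^ n * q ^ k := by
            rw [mul_left_comm, ← pow_add, Nat.add_sub_cancel' hkn]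

/-- Turovskii's theorem for irreducible families: if all words are quasinilpotent, then the family
has joint spectral radius zero. -/
lemma IsIrreducibleFamily.growthOn_top [CompleteSpace E] [Finite ι] {m : ι → E →L[ℂ] E}
    (hirr : IsIrreducibleFamily m) (hm : ∀ i, IsCompactOperator (m i))
    (hq : ∀ l : List ι, l ≠ [] → HasSuperexponentialDecay (word m l)) {r : ℝ} (hr : 0 < r) :
    GrowthOn m ⊤ r := by
  by_contra hnot
  have hup : ∀ {s t : ℝ}, 0 ≤ s → s ≤ t → GrowthOn m ⊤ s → GrowthOn m ⊤ t := by
    intro s t hs hst h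
    obtain ⟨C, hC0, hC⟩ := (growthOn_top_iff hs).1 h
    exact (growthOn_top_iff (hs.trans hst)).2 ⟨C, hC0, fun l => (hC l).trans (by gcongr)⟩
  -- `ρ` is the joint spectral radius; the family is rescaled to have joint spectral radius `1`.
  set G : Set ℝ := {s | 0 ≤ s ∧ GrowthOn m ⊤ s}
  set ρ : ℝ := sInf G
  have hGne : G.Nonempty := by
    obtain ⟨B, hB⟩ := (Set.finite_range fun i => ‖m i‖).bddAbove
    refine ⟨max B 0, le_max_right _ _, (growthOn_top_iff (le_max_right _ _)).2
      ⟨1, zero_le_one, fun l => ?_⟩⟩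
    induction l with
    | nil =>
      rw [word_nil, List.length_nil, pow_zero, one_mul]
      exact ContinuousLinearMap.norm_id_le
    | cons i l ih =>
      rw [one_mul] at ih ⊢
      rw [word_cons, List.length_cons, pow_succ']
      exact (norm_mul_le _ _).trans (mul_le_mul ((hB ⟨i, rfl⟩).trans (le_max_left _ _)) ih
        (norm_nonneg _) (by positivity))
  have hrG : ∀ s ∈ G, r ≤ s := fun s hs => by
    by_contra! h
    exact hnot (hup hs.1 h.le hs.2)
  have hρr : r ≤ ρ := le_csInf hGne hrG
  have hρ : 0 < ρ := hr.trans_le hρr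
  have hbelow : ∀ s, 0 ≤ s → s < ρ → ¬ GrowthOn m ⊤ s := fun s hs0 hs h =>
    absurd (csInf_le ⟨r, hrG⟩ ⟨hs0, h⟩) hs.not_ge
  set m' : ι → E →L[ℂ] E := fun i => ((ρ⁻¹ : ℝ) : ℂ) • m i with hm'
  have hword : ∀ l, word m' l = (((ρ⁻¹ : ℝ) : ℂ) ^ l.length) • word m l := word_smul m _
  have hnorm : ∀ l, ‖word m' l‖ = ρ⁻¹ ^ l.length * ‖word m l‖ := fun l => by
    rw [hword, norm_smul, norm_pow, Complex.norm_real, Real.norm_of_nonneg (by positivity)]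
  have hgrow : ∀ s > 1, GrowthOn m' ⊤ s := by
    intro s hs
    obtain ⟨t, ⟨ht0, ht⟩, hts⟩ := exists_lt_of_csInf_lt hGne (show ρ < ρ * s by nlinarith)
    obtain ⟨C, hC0, hC⟩ := (growthOn_top_iff (by positivity)).1 (hup ht0 hts.le ht)
    refine (growthOn_top_iff (by linarith)).2 ⟨C, hC0, fun l => ?_⟩
    rw [hnorm]
    calc ρ⁻¹ ^ l.length * ‖word m l‖ ≤ ρ⁻¹ ^ l.length * (C * (ρ * s) ^ l.length) := by
          gcongr; exact hC l
      _ = C * (ρ⁻¹ * (ρ * s)) ^ l.length := by rw [mul_pow ρ⁻¹]; ring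
      _ = C * s ^ l.length := by rw [inv_mul_cancel_left₀ hρ.ne']
  have hc' : ∀ i, IsCompactOperator (m' i) := fun i => (hm i).smul _
  have hirr' : IsIrreducibleFamily m' := by
    intro Y hY hinv
    refine hirr Y hY fun i x hx => ?_
    have := Y.smul_mem (ρ : ℂ) (hinv i x hx)
    simpa [hm', smul_smul, hρ.ne'] using this
  have hq' : ∀ l : List ι, l ≠ [] → HasSuperexponentialDecay (word m' l) := by
    intro l hl ε hε
    set c : ℝ := ρ⁻¹ ^ l.length
    have hc : 0 < c := by positivity
    obtain ⟨C, hC⟩ := hq l hl (ε / c) (by positivity)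
    refine ⟨C, fun n => ?_⟩
    rw [hword, smul_pow, norm_smul, norm_pow, norm_pow, Complex.norm_real,
      Real.norm_of_nonneg (by positivity)]
    calc c ^ n * ‖word m l ^ n‖ ≤ c ^ n * (C * (ε / c) ^ n) := by gcongr; exact hC n
      _ = C * (c * (ε / c)) ^ n := by rw [mul_pow]; ring
      _ = C * ε ^ n := by rw [mul_div_cancel₀ _ hc.ne']
  obtain ⟨C, hC⟩ := exists_norm_word_le_of_growthOn hc' hirr' hgrow
  obtain ⟨n, hn⟩ := exists_length_norm_word_le hc' hq' hC
  have hsmall : ∃ q : ℝ, 0 < q ∧ q < 1 ∧ GrowthOn m' ⊤ q := by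
    rcases eq_or_ne n 0 with rfl | hn0
    · -- The empty word is the identity, so the space is trivial.
      have h1 := hn [] rfl
      have h2 : ‖(1 : E →L[ℂ] E)‖ ≤ ‖(1 : E →L[ℂ] E)‖ * ‖(1 : E →L[ℂ] E)‖ := by
        simpa using norm_mul_le (1 : E →L[ℂ] E) 1
      have h3 : (1 : E →L[ℂ] E) = 0 := by
        rw [word_nil] at h1
        rw [← norm_le_zero_iff]
        nlinarith [norm_nonneg (1 : E →L[ℂ] E)]
      refine ⟨1 / 2, by norm_num, by norm_num, (growthOn_top_iff (by norm_num)).2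
        ⟨0, le_rfl, fun l => ?_⟩⟩
      rw [← mul_one (word m' l), h3]
      simp
    · refine ⟨(1 / 2 : ℝ) ^ ((n : ℝ)⁻¹), by positivity, Real.rpow_lt_one (by norm_num)
        (by norm_num) (by positivity), growthOn_of_norm_word_le_pow hn0 (by positivity)
        (Real.rpow_le_one (by norm_num) (by norm_num) (by positivity)) hC fun l hl => ?_⟩
      rw [Real.rpow_inv_natCast_pow (by norm_num) hn0]
      exact hn l hl
  obtain ⟨q, hq0, hq1, hgq⟩ := hsmall
  refine hbelow (ρ * q) (by positivity) (by nlinarith) ?_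
  obtain ⟨C, hC0, hC⟩ := (growthOn_top_iff hq0.le).1 hgq
  refine (growthOn_top_iff (by positivity)).2 ⟨C, hC0, fun l => ?_⟩
  have := hC l
  rw [hnorm, inv_pow, inv_mul_le_iff₀ (by positivity)] at this
  rw [mul_pow]
  linarith

end Irreducible

/-! ### Reduction to irreducible families -/

section Triangular

variable {ι E : Type*} [NormedAddCommGroup E] [NormedSpace ℂ E]

/-- Members of a chain of closed invariant subspaces decreasing to `Y`: modulo `Y`, the compact
operators `m i` have arbitrarily small norm on some member of the chain. -/
lemma exists_small_mod_sInf [Finite ι] {m : ι → E →L[ℂ] E} (hm : ∀ i, IsCompactOperator (m i))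
    {c : Set (Submodule ℂ E)} (hne : c.Nonempty) (hchain : IsChain (· ≤ ·) c)
    (hc : ∀ N ∈ c, IsClosed (N : Set E) ∧ ∀ i, ∀ x ∈ N, m i x ∈ N) {ε : ℝ} (hε : 0 < ε) :
    ∃ N ∈ c, ∀ i, ∀ x ∈ N, ∃ y ∈ sInf c, ‖m i x - y‖ ≤ ε * ‖x‖ := by
  by_contra! hbad
  set Q : Set E := ⋃ i, closure (m i '' Metric.closedBall 0 1)
  have hQ : IsCompact Q := isCompact_iUnion fun i =>
    (hm i).isCompact_closure_image_closedBall (f := (m i : E →ₗ[ℂ] E)) 1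
  set B : c → Set E := fun N => Q ∩ ((N.1 : Set E) ∩ {z | ∀ y ∈ sInf c, ε ≤ ‖z - y‖}) with hB
  have hcl : ∀ N : c, IsClosed ((N.1 : Set E) ∩ {z | ∀ y ∈ sInf c, ε ≤ ‖z - y‖}) := fun N => by
    refine (hc N.1 N.2).1.inter ?_
    simp only [Set.ofPred_forall]
    exact isClosed_biInter fun y _ =>
      isClosed_le continuous_const (continuous_id.sub continuous_const).norm
  have : Nonempty c := hne.to_subtype
  obtain ⟨z, hz⟩ := IsCompact.nonempty_iInter_of_directed_nonempty_isCompact_isClosed B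
    (fun N N' => by
      rcases hchain.total N.2 N'.2 with h | h
      · exact ⟨N, le_rfl, fun z hz => ⟨hz.1, h hz.2.1, hz.2.2⟩⟩
      · exact ⟨N', fun z hz => ⟨hz.1, h hz.2.1, hz.2.2⟩, le_rfl⟩)
    (fun N => by
      obtain ⟨i, x, hx, h⟩ := hbad N.1 N.2
      have hx0 : 0 < ‖x‖ := by
        rw [norm_pos_iff]
        rintro rfl
        simpa using h 0 (zero_mem _)
      set t : ℂ := ((‖x‖⁻¹ : ℝ) : ℂ) with ht
      have htn : ‖t‖ = ‖x‖⁻¹ := by rw [ht, Complex.norm_real, norm_inv, norm_norm]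
      have hxt : ‖t • x‖ = 1 := by rw [norm_smul, htn, inv_mul_cancel₀ hx0.ne']
      have ht0 : t ≠ 0 := by rw [← norm_ne_zero_iff, htn]; positivity
      refine ⟨m i (t • x), Set.mem_iUnion.2 ⟨i, subset_closure ⟨t • x, by simp [hxt], rfl⟩⟩,
        (hc N.1 N.2).2 i _ (N.1.smul_mem t hx), fun y hy => ?_⟩
      have h1 := h (t⁻¹ • y) (Submodule.smul_mem _ _ hy)
      have h2 : m i (t • x) - y = t • (m i x - t⁻¹ • y) := by
        rw [smul_sub, smul_inv_smul₀ ht0, map_smul]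
      rw [h2, norm_smul, htn, ← div_eq_inv_mul, le_div_iff₀ hx0]
      exact h1.le)
    (fun N => hQ.inter_right (hcl N)) (fun N => hQ.isClosed.inter (hcl N))
  rw [Set.mem_iInter] at hz
  have hzY : z ∈ sInf c := Submodule.mem_sInf.2 fun N hN => (hz ⟨N, hN⟩).2.1
  have := (hz ⟨_, hne.some_mem⟩).2.2 z hzY
  rw [sub_self, norm_zero] at this
  linarith

/-- In a chain of subspaces with dense union, the compact operators `m i` have arbitrarily small
norm modulo some member of the chain. -/
lemma exists_small_mod_of_dense [Finite ι] {m : ι → E →L[ℂ] E} (hm : ∀ i, IsCompactOperator (m i))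
    {c : Set (Submodule ℂ E)} (hne : c.Nonempty) (hchain : IsChain (· ≤ ·) c)
    (hdense : (sSup c).topologicalClosure = ⊤) {ε : ℝ} (hε : 0 < ε) :
    ∃ N ∈ c, ∀ i, ∀ x, ∃ y ∈ N, ‖m i x - y‖ ≤ ε * ‖x‖ := by
  set Q : Set E := ⋃ i, closure (m i '' Metric.closedBall 0 1)
  have hQ : IsCompact Q := isCompact_iUnion fun i =>
    (hm i).isCompact_closure_image_closedBall (f := (m i : E →ₗ[ℂ] E)) 1
  have : Nonempty c := hne.to_subtype
  obtain ⟨N, hN⟩ := hQ.elim_directed_cover (fun N : c => ⋃ y ∈ N.1, Metric.ball y ε)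
    (fun N => isOpen_biUnion fun y _ => Metric.isOpen_ball)
    (fun z _ => by
      obtain ⟨y, hy, hd⟩ := (Submodule.dense_iff_topologicalClosure_eq_top.2 hdense).exists_dist_lt
        z hε
      obtain ⟨N, hN, hyN⟩ := (Submodule.mem_sSup_of_directed hne hchain.directedOn).1 hy
      exact Set.mem_iUnion.2 ⟨⟨N, hN⟩, Set.mem_iUnion₂.2 ⟨y, hyN, hd⟩⟩)
    (fun N N' => by
      rcases hchain.total N.2 N'.2 with h | h
      · exact ⟨N', Set.biUnion_subset_biUnion_left h, le_rfl⟩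
      · exact ⟨N, le_rfl, Set.biUnion_subset_biUnion_left h⟩)
  refine ⟨N.1, N.2, fun i x => ?_⟩
  rcases eq_or_ne x 0 with rfl | hx
  · exact ⟨0, zero_mem _, by simp⟩
  have hx0 : 0 < ‖x‖ := norm_pos_iff.2 hx
  set t : ℂ := ((‖x‖⁻¹ : ℝ) : ℂ) with ht
  have htn : ‖t‖ = ‖x‖⁻¹ := by rw [ht, Complex.norm_real, norm_inv, norm_norm]
  have hxt : ‖t • x‖ = 1 := by rw [norm_smul, htn, inv_mul_cancel₀ hx0.ne']
  have ht0 : t ≠ 0 := by rw [← norm_ne_zero_iff, htn]; positivity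
  obtain ⟨y, hy, hd⟩ := Set.mem_iUnion₂.1 (hN (Set.mem_iUnion.2 ⟨i, subset_closure
    ⟨t • x, by simp [hxt], rfl⟩⟩ : m i (t • x) ∈ Q))
  refine ⟨t⁻¹ • y, N.1.smul_mem _ hy, ?_⟩
  have h2 : m i (t • x) - y = t • (m i x - t⁻¹ • y) := by
    rw [smul_sub, smul_inv_smul₀ ht0, map_smul]
  rw [Metric.mem_ball, dist_eq_norm, h2, norm_smul, htn, ← div_eq_inv_mul, div_lt_iff₀ hx0] at hd
  exact hd.le

/-- The joint spectral radius of a block triangular family is controlled by the diagonal blocks: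
words grow at most like `r ^ n` on `N` if they do so on `Y ≤ N` and grow at most like `s ^ n`
modulo `Y`, where `s < r`. -/
lemma GrowthOn.of_mod [Finite ι] {m : ι → E →L[ℂ] E} {Y N : Submodule ℂ E} (hYN : Y ≤ N)
    (hY : ∀ i, ∀ x ∈ Y, m i x ∈ Y) (hN : ∀ i, ∀ x ∈ N, m i x ∈ N) {r s : ℝ} (hs : 0 < s)
    (hsr : s < r) (hgrow : GrowthOn m Y r)
    (hmod : ∃ C : ℝ, ∀ l : List ι, ∀ x ∈ N, ∃ y ∈ Y, ‖word m l x - y‖ ≤ C * s ^ l.length * ‖x‖) :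
    GrowthOn m N r := by
  have hr : 0 < r := hs.trans hsr
  obtain ⟨C, hC0, hC⟩ := hgrow.exists_nonneg hr.le
  obtain ⟨B, hB⟩ := (Set.finite_range fun i => ‖m i‖).bddAbove
  set μ : ℝ := max B 0
  have hμ : ∀ i, ‖m i‖ ≤ μ := fun i => (hB ⟨i, rfl⟩).trans (le_max_left _ _)
  have hμ0 : 0 ≤ μ := le_max_right _ _
  set A : ℝ := 1 + C * (μ + s) / (r - s) with hA
  have hrs : 0 < r - s := sub_pos.2 hsr
  have hA1 : 1 ≤ A := by rw [hA]; linarith [show 0 ≤ C * (μ + s) / (r - s) by positivity]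
  have hAr : A * s + C * (μ + s) ≤ A * r := by
    have : C * (μ + s) / (r - s) * (r - s) = C * (μ + s) := div_mul_cancel₀ _ hrs.ne'
    nlinarith
  -- A vector that is small, and whose orbit modulo `Y` is small, is moved step by step; after each
  -- step the excess is split off into `Y`, where the growth is known.
  have key : ∀ l : List ι, ∀ t : ℝ, 0 ≤ t → ∀ z ∈ N, ‖z‖ ≤ t →
      (∀ w : List ι, ∃ y ∈ Y, ‖word m w z - y‖ ≤ t * s ^ w.length) →
      ‖word m l z‖ ≤ A * t * r ^ l.length := by
    intro l
    induction l using List.reverseRecOn with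
    | nil => intro t ht z _ hz _; simpa using hz.trans (le_mul_of_one_le_left ht hA1)
    | append_singleton l i ih =>
      intro t ht z hzN hz horb
      obtain ⟨y, hy, hyn⟩ := horb [i]
      simp only [word_cons, word_nil, mul_one, List.length_singleton, pow_one] at hyn
      have h1 := ih (t * s) (by positivity) (m i z - y) (sub_mem (hN i z hzN) (hYN hy)) hyn
        (fun w => by
          obtain ⟨y', hy', h⟩ := horb (w ++ [i])
          refine ⟨y' - word m w y, sub_mem hy' (word_mapsTo hY w hy), ?_⟩
          have e : word m w (m i z - y) - (y' - word m w y) = word m (w ++ [i]) z - y' := by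
            simp
          rw [e]
          refine h.trans_eq ?_
          rw [List.length_append, List.length_singleton, pow_succ]; ring)
      have h2 : ‖y‖ ≤ (μ + s) * t := by
        have h3 := norm_sub_norm_le y (m i z)
        rw [norm_sub_rev] at h3
        have h4 := (m i).le_of_opNorm_le_of_le (hμ i) hz
        linarith
      have h3 : ‖word m l y‖ ≤ C * r ^ l.length * ((μ + s) * t) := (hC l y hy).trans (by gcongr)
      have e : word m (l ++ [i]) z = word m l (m i z - y) + word m l y := by simp
      rw [e, List.length_append, List.length_singleton, pow_succ]
      calc ‖word m l (m i z - y) + word m l y‖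
          ≤ A * (t * s) * r ^ l.length + C * r ^ l.length * ((μ + s) * t) :=
            (norm_add_le _ _).trans (add_le_add h1 h3)
        _ = (A * s + C * (μ + s)) * (t * r ^ l.length) := by ring
        _ ≤ A * r * (t * r ^ l.length) := by gcongr
        _ = A * t * (r ^ l.length * r) := by ring
  obtain ⟨D, hD⟩ := hmod
  refine ⟨A * (max D 1), fun l x hx => ?_⟩
  have := key l (max D 1 * ‖x‖) (by positivity) x hx
    (le_mul_of_one_le_left (norm_nonneg _) (le_max_right _ _)) (fun w => by
      obtain ⟨y, hy, h⟩ := hD w x hx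
      refine ⟨y, hy, h.trans ?_⟩
      rw [mul_right_comm]
      gcongr
      exact le_max_left _ _)
  exact this.trans_eq (by ring)

/-- Operators of norm at most `s` modulo `Y` have words of norm at most `s ^ n` modulo `Y`. -/
lemma exists_word_mod_le {m : ι → E →L[ℂ] E} {Y N : Submodule ℂ E} (hYN : Y ≤ N)
    (hY : ∀ i, ∀ x ∈ Y, m i x ∈ Y) (hN : ∀ i, ∀ x ∈ N, m i x ∈ N) {s : ℝ} (hs : 0 < s)
    (h : ∀ i, ∀ x ∈ N, ∃ y ∈ Y, ‖m i x - y‖ ≤ s * ‖x‖) :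
    ∃ C : ℝ, ∀ l : List ι, ∀ x ∈ N, ∃ y ∈ Y, ‖word m l x - y‖ ≤ C * s ^ l.length * ‖x‖ := by
  refine ⟨1, fun l x hx => ?_⟩
  induction l with
  | nil => exact ⟨0, zero_mem _, by simp⟩
  | cons i l ih =>
    obtain ⟨y, hy, hyn⟩ := ih
    obtain ⟨y', hy', hyn'⟩ := h i (word m l x - y) (sub_mem (word_mapsTo hN l hx) (hYN hy))
    refine ⟨y' + m i y, add_mem hy' (hY i y hy), ?_⟩
    have e : word m (i :: l) x - (y' + m i y) = m i (word m l x - y) - y' := by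
      simp; abel
    rw [e, List.length_cons, pow_succ']
    calc ‖m i (word m l x - y) - y'‖ ≤ s * (1 * s ^ l.length * ‖x‖) := hyn'.trans (by gcongr)
      _ = 1 * (s * s ^ l.length) * ‖x‖ := by ring

lemma HasSuperexponentialDecay.of_norm_pow_le {A B : Type*} [NormedRing A] [NormedRing B] {v : A}
    {v' : B} (hv : HasSuperexponentialDecay v) {K : ℝ} (hK : 0 ≤ K)
    (h : ∀ n : ℕ, ‖v' ^ n‖ ≤ K * ‖v ^ n‖) : HasSuperexponentialDecay v' := by
  intro ε hε
  obtain ⟨C, hC⟩ := hv ε hε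
  refine ⟨K * C, fun n => (h n).trans ?_⟩
  rw [mul_assoc]
  gcongr
  exact hC n

lemma pow_semiconj {F : Type*} [NormedAddCommGroup F] [NormedSpace ℂ F] {v : E →L[ℂ] E}
    {v' : F →L[ℂ] F} {π : E → F} (h : ∀ x, π (v x) = v' (π x)) (n : ℕ) (x : E) :
    π ((v ^ n) x) = (v' ^ n) (π x) := by
  induction n generalizing x with
  | zero => simp
  | succ n ih => rw [pow_succ, pow_succ, mul_apply_eq_comp, mul_apply_eq_comp, ih, h]

/-- The family induced on a quotient by an invariant subspace. -/
def quotientFamily (m : ι → E →L[ℂ] E) (Z : Submodule ℂ E) (hZ : ∀ i, ∀ x ∈ Z, m i x ∈ Z)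
    (i : ι) : (E ⧸ Z) →L[ℂ] (E ⧸ Z) :=
  Z.liftQL (Z.mkQL ∘L m i) fun x hx => by simpa using hZ i x hx

/-- If words grow at most like `r ^ n` on each proper closed invariant subspace, then they do so on
the whole space. A maximal proper closed invariant subspace exists, unless such subspaces have
dense union and then the family is small modulo one of them; the quotient by a maximal one is
irreducible. -/
lemma growthOn_top_of_forall_proper [CompleteSpace E] [Finite ι] {m : ι → E →L[ℂ] E}
    (hm : ∀ i, IsCompactOperator (m i))
    (hq : ∀ l : List ι, l ≠ [] → HasSuperexponentialDecay (word m l)) {r : ℝ} (hr : 0 < r)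
    (hproper : ∀ Y : Submodule ℂ E, IsClosed (Y : Set E) → (∀ i, ∀ x ∈ Y, m i x ∈ Y) → Y ≠ ⊤ →
      GrowthOn m Y r) : GrowthOn m ⊤ r := by
  by_contra hnot
  set P : Set (Submodule ℂ E) :=
    {Z | IsClosed (Z : Set E) ∧ (∀ i, ∀ x ∈ Z, m i x ∈ Z) ∧ Z ≠ ⊤} with hP
  have hbot : (⊥ : Submodule ℂ E) ∈ P := by
    refine ⟨by simp, fun i x hx => by simp_all, fun h => hnot ⟨0, fun l y hy => ?_⟩⟩
    rw [← h, Submodule.mem_bot] at hy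
    simp [hy]
  obtain ⟨Z, -, hZ⟩ := zorn_le_nonempty₀ P (fun c hc hchain Z₀ hZ₀ => by
    refine ⟨(sSup c).topologicalClosure, ⟨Submodule.isClosed_topologicalClosure _,
      fun i x hx => map_mem_closure (m i).continuous hx fun y hy => ?_, fun htop => ?_⟩,
      fun Z hZ => (le_sSup hZ).trans (Submodule.le_topologicalClosure _)⟩
    · obtain ⟨Z, hZ, hyZ⟩ := (Submodule.mem_sSup_of_directed ⟨Z₀, hZ₀⟩ hchain.directedOn).1 hy
      exact le_sSup hZ ((hc hZ).2.1 i y hyZ)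
    · obtain ⟨Z, hZ, hsmall⟩ := exists_small_mod_of_dense hm ⟨Z₀, hZ₀⟩ hchain htop (half_pos hr)
      obtain ⟨hZc, hZi, hZt⟩ := hc hZ
      exact hnot ((hproper Z hZc hZi hZt).of_mod le_top hZi (fun _ _ _ => trivial) (half_pos hr)
        (half_lt_self hr) (exists_word_mod_le le_top hZi (fun _ _ _ => trivial) (half_pos hr)
          fun i x _ => hsmall i x))) ⊥ hbot
  obtain ⟨hZc, hZi, hZt⟩ := hZ.prop
  have : IsClosed (Z : Set E) := hZc
  set m' := quotientFamily m Z hZi with hm'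
  have hsemi : ∀ i x, Z.mkQ (m i x) = m' i (Z.mkQ x) := fun i x => rfl
  have hcomp : ∀ i, IsCompactOperator (m' i) := by
    intro i
    obtain ⟨K, hK, hK0⟩ := hm i
    refine ⟨Z.mkQL '' K, hK.image Z.mkQL.continuous, ?_⟩
    have h1 := Z.isOpenQuotientMap_mkQL.isOpenMap.image_mem_nhds hK0
    rw [map_zero] at h1
    refine mem_of_superset h1 ?_
    rintro _ ⟨x, hx, rfl⟩
    exact ⟨m i x, hx, rfl⟩
  have hirr : IsIrreducibleFamily m' := by
    intro Y hYc hYi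
    have hle : Z ≤ Y.comap Z.mkQ := fun x hx => by
      rw [Submodule.mem_comap, Submodule.mkQ_apply, (Submodule.Quotient.mk_eq_zero Z).2 hx]
      exact zero_mem _
    by_cases htop : Y.comap Z.mkQ = ⊤
    · right
      rw [eq_top_iff]
      rintro q -
      obtain ⟨x, rfl⟩ := Z.mkQ_surjective q
      exact (htop ▸ Submodule.mem_top : x ∈ Y.comap Z.mkQ)
    · left
      have hmem : Y.comap Z.mkQ ∈ P := ⟨hYc.preimage Z.mkQL.continuous, fun i x hx => by
        rw [Submodule.mem_comap, hsemi]; exact hYi i _ hx, htop⟩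
      have hge := hZ.le_of_ge hmem hle
      rw [eq_bot_iff]
      intro q hqY
      obtain ⟨x, rfl⟩ := Z.mkQ_surjective q
      rw [Submodule.mem_bot]
      exact (Submodule.Quotient.mk_eq_zero Z).2 (hge hqY)
  have hlift : ∀ q : E ⧸ Z, ∃ x, Z.mkQ x = q ∧ ‖x‖ ≤ 2 * ‖q‖ := by
    intro q
    rcases eq_or_ne q 0 with rfl | hq0
    · exact ⟨0, by simp⟩
    · obtain ⟨x, hx, hn⟩ := Submodule.Quotient.norm_mk_lt q (norm_pos_iff.2 hq0)
      exact ⟨x, hx, by linarith⟩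
  have hq' : ∀ l : List ι, l ≠ [] → HasSuperexponentialDecay (word m' l) := by
    intro l hl
    refine (hq l hl).of_norm_pow_le (K := 2) (by norm_num) fun n => ?_
    refine ContinuousLinearMap.opNorm_le_bound _ (by positivity) fun q => ?_
    obtain ⟨x, rfl, hx⟩ := hlift q
    rw [← pow_semiconj (π := Z.mkQ) (word_semiconj hsemi l)]
    calc ‖Z.mkQ ((word m l ^ n) x)‖ ≤ ‖(word m l ^ n) x‖ := Submodule.Quotient.norm_mk_le _ _
      _ ≤ ‖word m l ^ n‖ * (2 * ‖Z.mkQ x‖) := ContinuousLinearMap.le_opNorm_of_le _ hx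
      _ = 2 * ‖word m l ^ n‖ * ‖Z.mkQ x‖ := by ring
  obtain ⟨C, hC0, hC⟩ := (hirr.growthOn_top hcomp hq' (half_pos hr)).exists_nonneg (half_pos hr).le
  refine hnot ((hproper Z hZc hZi hZt).of_mod le_top hZi (fun _ _ _ => trivial) (half_pos hr)
    (half_lt_self hr) ⟨2 * C, fun l x _ => ?_⟩)
  obtain ⟨x', hx', hn⟩ := hlift (Z.mkQ (word m l x))
  refine ⟨word m l x - x', ?_, ?_⟩
  · rw [← Submodule.Quotient.mk_eq_zero, ← Submodule.mkQ_apply, map_sub, hx', sub_self]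
  · rw [sub_sub_cancel]
    refine hn.trans ?_
    rw [word_semiconj hsemi]
    have h1 := hC l (Z.mkQ x) trivial
    have h2 : ‖Z.mkQ x‖ ≤ ‖x‖ := Submodule.Quotient.norm_mk_le _ _
    calc 2 * ‖word m' l (Z.mkQ x)‖ ≤ 2 * (C * (r / 2) ^ l.length * ‖x‖) := by
          gcongr
          exact h1.trans (by gcongr)
      _ = 2 * C * (r / 2) ^ l.length * ‖x‖ := by ring

/-- Turovskii's theorem: a finite family of compact operators all of whose words are quasinilpotent
has joint spectral radius zero. -/
theorem growthOn_top_of_quasinilpotent [CompleteSpace E] [Finite ι] {m : ι → E →L[ℂ] E}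
    (hm : ∀ i, IsCompactOperator (m i))
    (hq : ∀ l : List ι, l ≠ [] → HasSuperexponentialDecay (word m l)) {r : ℝ} (hr : 0 < r) :
    GrowthOn m ⊤ r := by
  by_contra hnot
  set P : Set (Submodule ℂ E)ᵒᵈ :=
    {Y | IsClosed ((OrderDual.ofDual Y : Submodule ℂ E) : Set E) ∧
      (∀ i, ∀ x ∈ OrderDual.ofDual Y, m i x ∈ OrderDual.ofDual Y) ∧
      ¬ GrowthOn m (OrderDual.ofDual Y) r} with hP
  obtain ⟨Y, -, hY⟩ := zorn_le_nonempty₀ P (fun c hc hchain Y₀ hY₀ => by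
    set d : Set (Submodule ℂ E) := OrderDual.ofDual '' c with hd
    have hdc : ∀ N ∈ d, IsClosed (N : Set E) ∧ (∀ i, ∀ x ∈ N, m i x ∈ N) ∧ ¬ GrowthOn m N r := by
      rintro _ ⟨N, hN, rfl⟩
      exact hc hN
    have hdi : ∀ i, ∀ x ∈ sInf d, m i x ∈ sInf d := fun i x hx =>
      Submodule.mem_sInf.2 fun N hN => (hdc N hN).2.1 i x (Submodule.mem_sInf.1 hx N hN)
    have hchain' : IsChain (· ≤ ·) d := by
      rintro _ ⟨N, hN, rfl⟩ _ ⟨N', hN', rfl⟩ hne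
      exact (hchain.total hN hN').symm
    refine ⟨OrderDual.toDual (sInf d), ⟨?_, hdi, fun hg => ?_⟩, fun N hN =>
      (sInf_le ⟨N, hN, rfl⟩ : sInf d ≤ OrderDual.ofDual N)⟩
    · rw [OrderDual.ofDual_toDual, Submodule.coe_sInf]
      exact isClosed_biInter fun N hN => (hdc N hN).1
    · obtain ⟨N, hN, hsmall⟩ := exists_small_mod_sInf hm (c := d) ⟨_, Y₀, hY₀, rfl⟩ hchain'
        (fun N hN => ⟨(hdc N hN).1, (hdc N hN).2.1⟩) (half_pos hr)
      have hle : sInf d ≤ N := sInf_le hN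
      exact (hdc N hN).2.2 (GrowthOn.of_mod hle hdi (hdc N hN).2.1 (half_pos hr) (half_lt_self hr)
        hg (exists_word_mod_le hle hdi (hdc N hN).2.1 (half_pos hr) hsmall)))
    (OrderDual.toDual ⊤) ⟨isClosed_univ, fun _ _ _ => trivial, hnot⟩
  obtain ⟨hYc, hYi, hYg⟩ := hY.prop
  set Y' : Submodule ℂ E := OrderDual.ofDual Y
  have : CompleteSpace Y' := hYc.completeSpace_coe
  set m' : ι → Y' →L[ℂ] Y' := fun i => (m i).restrict (hYi i) with hm'
  have hsemi : ∀ i (x : Y'), (m' i x : E) = m i x := fun i x => rfl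
  have hword : ∀ l (x : Y'), (word m' l x : E) = word m l x := fun l x =>
    word_semiconj (π := fun x : Y' => (x : E)) hsemi l x
  refine hYg ?_
  have hgrow : GrowthOn m' ⊤ r := by
    refine growthOn_top_of_forall_proper
      (fun i => (hm i).restrict (f := (m i : E →ₗ[ℂ] E)) (hYi i) hYc)
      (fun l hl => (hq l hl).of_norm_pow_le zero_le_one fun n => ?_) hr fun W hWc hWi hWt => ?_
    · rw [one_mul]
      refine ContinuousLinearMap.opNorm_le_bound _ (norm_nonneg _) fun x => ?_
      have := pow_semiconj (π := fun x : Y' => (x : E)) (hword l) n x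
      rw [Submodule.coe_norm, this]
      exact (word m l ^ n).le_opNorm _
    · by_contra hWg
      have hmem : OrderDual.toDual (W.map Y'.subtype) ∈ P := by
        refine ⟨?_, ?_, fun ⟨C, hC⟩ => hWg ⟨C, fun l x hx => ?_⟩⟩
        · exact (hYc.isClosedEmbedding_subtypeVal.isClosedMap) _ hWc
        · rintro i _ ⟨x, hx, rfl⟩
          exact ⟨m' i x, hWi i x hx, rfl⟩
        · have := hC l x ⟨x, hx, rfl⟩
          rwa [← hword] at this
      have hle : Y' ≤ W.map Y'.subtype :=
        hY.le_of_ge hmem (Submodule.map_subtype_le Y' W : W.map Y'.subtype ≤ Y')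
      refine hWt (eq_top_iff.2 fun x _ => ?_)
      obtain ⟨x', hx', h⟩ := hle x.2
      rwa [← Subtype.ext h]
  obtain ⟨C, hC⟩ := hgrow
  refine ⟨C, fun l y hy => ?_⟩
  have := hC l ⟨y, hy⟩ trivial
  rwa [Submodule.coe_norm, hword] at this

end Triangular

/-! ### Orbits under the hyperalgebra -/

section Hyperalgebra

variable {E : Type*} [NormedAddCommGroup E] [NormedSpace ℂ E]

lemma subset_hyperalgebra (S : Set (E →L[ℂ] E)) :
    S ∪ Set.centralizer S ⊆ (hyperalgebra S : Set (E →L[ℂ] E)) :=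
  NonUnitalAlgebra.subset_adjoin ℂ

/-- A non-zero vector whose orbit under the hyperalgebra is not dense spans a non-trivial closed
invariant subspace. -/
lemma isReducible_of_not_dense {S : Set (E →L[ℂ] E)} {y : E} (hy : y ≠ 0)
    (hd : ¬ Dense {z | ∃ h ∈ (hyperalgebra S : Set (E →L[ℂ] E)), h y = z}) :
    IsReducible (hyperalgebra S : Set (E →L[ℂ] E)) := by
  set Y : Submodule ℂ E := (hyperalgebra S).toSubmodule.map
    (ContinuousLinearMap.apply ℂ E y : (E →L[ℂ] E) →ₗ[ℂ] E)
  have hyY : y ∈ Y := ⟨1, subset_hyperalgebra S (Or.inr (Set.one_mem_centralizer)), rfl⟩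
  refine ⟨Y.topologicalClosure, ⟨fun h => hy ?_, fun h => hd ?_⟩,
    Y.isClosed_topologicalClosure, fun T hT x hx => map_mem_closure T.continuous hx ?_⟩
  · exact (Submodule.mem_bot ℂ).1 (h ▸ Y.le_topologicalClosure hyY)
  · exact Submodule.dense_iff_topologicalClosure_eq_top.2 h
  · rintro _ ⟨h, hh, rfl⟩
    exact ⟨T * h, mul_mem (s := hyperalgebra S) hT hh, rfl⟩

/-- Left multiplication by the hyperalgebra preserves a subspace of operators as soon as left
multiplication by its generators does. -/
lemma hyperalgebra_mul_mem {S : Set (E →L[ℂ] E)} {J : Submodule ℂ (E →L[ℂ] E)}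
    (hS : ∀ T ∈ S ∪ Set.centralizer S, ∀ g ∈ J, T * g ∈ J) {h : E →L[ℂ] E}
    (hh : h ∈ hyperalgebra S) : ∀ g ∈ J, h * g ∈ J := by
  induction hh using NonUnitalAlgebra.adjoin_induction with
  | mem T hT => exact hS T hT
  | add T T' _ _ ih ih' => intro g hg; rw [add_mul]; exact add_mem (ih g hg) (ih' g hg)
  | zero => intro g _; rw [zero_mul]; exact zero_mem _
  | mul T T' _ _ ih ih' => intro g hg; rw [mul_assoc]; exact ih _ (ih' g hg)
  | smul c T _ ih => intro g hg; rw [smul_mul_assoc]; exact Submodule.smul_mem _ _ (ih g hg)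

end Hyperalgebra

/-! ### Algebras containing a non-zero compact operator -/

section CompactCase

variable {E : Type*} [NormedAddCommGroup E] [NormedSpace ℂ E]

/-- The span of the products `c * k`, where `c` commutes with the algebra `A` and `k ∈ A` is
compact. -/
def commutantSpan (A : NonUnitalSubalgebra ℂ (E →L[ℂ] E)) : Submodule ℂ (E →L[ℂ] E) :=
  Submodule.span ℂ {g | ∃ c ∈ Set.centralizer (A : Set (E →L[ℂ] E)), ∃ k ∈ A,
    IsCompactOperator k ∧ g = c * k}

lemma mul_mem_commutantSpan {A : NonUnitalSubalgebra ℂ (E →L[ℂ] E)} {h : E →L[ℂ] E}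
    (hh : h ∈ hyperalgebra (A : Set (E →L[ℂ] E))) :
    ∀ g ∈ commutantSpan A, h * g ∈ commutantSpan A := by
  refine hyperalgebra_mul_mem (fun T hT g hg => ?_) hh
  induction hg using Submodule.span_induction with
  | mem g hg =>
    obtain ⟨c, hc, k, hk, hkc, rfl⟩ := hg
    refine Submodule.subset_span ?_
    rcases hT with hT | hT
    · refine ⟨c, hc, T * k, mul_mem hT hk, hkc.clm_comp T, ?_⟩
      rw [← mul_assoc, ← mul_assoc, hc T hT]
    · exact ⟨T * c, Set.mul_mem_centralizer hT hc, k, hk, hkc, (mul_assoc _ _ _).symm⟩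
  | zero => rw [mul_zero]; exact zero_mem _
  | add g g' _ _ ih ih' => rw [mul_add]; exact add_mem ih ih'
  | smul c g _ ih => rw [mul_smul_comm]; exact Submodule.smul_mem _ _ ih

/-- Finitely many members of `commutantSpan A` change orbit growth, taken with respect to a large
enough finite set of compact operators in `A`, like those operators do, up to a constant: the
factors from the commutant move past words. -/
lemma exists_mapsTo_orbitBall_of_mem_commutantSpan (A : NonUnitalSubalgebra ℂ (E →L[ℂ] E))
    (G : Finset (E →L[ℂ] E)) (hG : ∀ g ∈ G, g ∈ commutantSpan A) :
    ∃ F : Finset (E →L[ℂ] E), (∀ k ∈ F, k ∈ A ∧ IsCompactOperator k) ∧ ∃ K : ℝ, 0 ≤ K ∧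
      ∀ g ∈ G, ∀ r t : ℝ, 0 ≤ r → 0 ≤ t → ∀ x ∈ orbitBall (Subtype.val : F → E →L[ℂ] E) r t,
        g x ∈ orbitBall (Subtype.val : F → E →L[ℂ] E) r (K * r * t) := by
  classical
  have single : ∀ g ∈ commutantSpan A, ∃ F : Finset (E →L[ℂ] E),
      (∀ k ∈ F, k ∈ A ∧ IsCompactOperator k) ∧ ∃ K : ℝ, 0 ≤ K ∧
      ∀ F' : Finset (E →L[ℂ] E), F ⊆ F' → (∀ k ∈ F', k ∈ A) → ∀ r t : ℝ, 0 ≤ r → 0 ≤ t →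
        ∀ x ∈ orbitBall (Subtype.val : F' → E →L[ℂ] E) r t,
          g x ∈ orbitBall (Subtype.val : F' → E →L[ℂ] E) r (K * r * t) := by
    intro g hg
    induction hg using Submodule.span_induction with
    | mem g hg =>
      obtain ⟨c, hc, k, hk, hkc, rfl⟩ := hg
      refine ⟨{k}, by simpa using ⟨hk, hkc⟩, ‖c‖, norm_nonneg _, fun F' hF' hA r t hr ht x hx => ?_⟩
      have h1 := word_mem_orbitBall hx [⟨k, hF' (Finset.mem_singleton_self k)⟩]
      have h2 := apply_mem_orbitBall_of_commute h1 (c := c) fun i => (hc i.1 (hA i.1 i.2)).symm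
      simp only [word_cons, word_nil, mul_one, List.length_singleton, pow_one] at h2
      rwa [mul_assoc, mul_comm r t]
    | zero =>
      exact ⟨∅, by simp, 0, le_rfl, fun F' _ _ r t hr ht x hx l => by simp⟩
    | add g g' _ _ ih ih' =>
      obtain ⟨F, hF, K, hK, H⟩ := ih
      obtain ⟨F₂, hF₂, K₂, hK₂, H₂⟩ := ih'
      refine ⟨F ∪ F₂, fun k hk => (Finset.mem_union.1 hk).elim (hF k) (hF₂ k), K + K₂,
        by positivity, fun F' hF' hA r t hr ht x hx => ?_⟩
      rw [add_mul, add_mul]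
      exact add_mem_orbitBall (H F' (Finset.union_subset_left hF') hA r t hr ht x hx)
        (H₂ F' (Finset.union_subset_right hF') hA r t hr ht x hx)
    | smul c g _ ih =>
      obtain ⟨F, hF, K, hK, H⟩ := ih
      refine ⟨F, hF, ‖c‖ * K, by positivity, fun F' hF' hA r t hr ht x hx => ?_⟩
      have := smul_mem_orbitBall (H F' hF' hA r t hr ht x hx) c
      rwa [← mul_assoc, ← mul_assoc] at this
  choose! F hF K hK H using single
  have hFA : ∀ k ∈ G.biUnion F, k ∈ A ∧ IsCompactOperator k := fun k hk => by
    obtain ⟨g, hg, hkg⟩ := Finset.mem_biUnion.1 hk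
    exact hF g (hG g hg) k hkg
  refine ⟨G.biUnion F, hFA, ∑ g ∈ G, K g, Finset.sum_nonneg fun g hg => hK g (hG g hg),
    fun g hg r t hr ht x hx => ?_⟩
  refine orbitBall_mono hr ?_ (H g (hG g hg) _ (Finset.subset_biUnion_of_mem F hg)
    (fun k hk => (hFA k hk).1) r t hr ht x hx)
  gcongr
  exact Finset.single_le_sum (f := K) (fun g hg => hK g (hG g hg)) hg

/-- The hyperalgebra of an algebra of quasinilpotent operators containing a compact operator
`k ≠ 0` is reducible. Otherwise Hilden's argument provides operators `h` in the hyperalgebra such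
that products of the operators `h * k` do not tend to zero, although they are combinations of
products of compact operators from the algebra, with coefficients in the commutant. -/
lemma isReducible_of_isCompactOperator [CompleteSpace E] (A : NonUnitalSubalgebra ℂ (E →L[ℂ] E))
    (hquasi : ∀ T ∈ A, IsQuasinilpotent T) {k : E →L[ℂ] E} (hkA : k ∈ A)
    (hk : IsCompactOperator k) (hk0 : k ≠ 0) :
    IsReducible (hyperalgebra (A : Set (E →L[ℂ] E)) : Set (E →L[ℂ] E)) := by
  classical
  by_contra hirr
  obtain ⟨x₀, hx₀, G, hG, δ, hδ, hret⟩ := exists_finite_return hk hk0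
    (H := (hyperalgebra (A : Set (E →L[ℂ] E)) : Set (E →L[ℂ] E)))
    fun y hy => by_contra fun hd => hirr (isReducible_of_not_dense hy hd)
  have hkJ : k ∈ commutantSpan A :=
    Submodule.subset_span ⟨1, Set.one_mem_centralizer, k, hkA, hk, (one_mul k).symm⟩
  obtain ⟨F, hF, K, hK, hFK⟩ := exists_mapsTo_orbitBall_of_mem_commutantSpan A
    (G.image fun h => h * k) (by
      simp only [Finset.mem_image]
      rintro _ ⟨h, hh, rfl⟩
      exact mul_mem_commutantSpan (hG hh) k hkJ)
  have hword : ∀ l : List F, l ≠ [] → word (Subtype.val : F → E →L[ℂ] E) l ∈ A := by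
    intro l hl
    induction l with
    | nil => exact absurd rfl hl
    | cons i l ih =>
      rcases eq_or_ne l [] with rfl | hl'
      · simpa using (hF i.1 i.2).1
      · rw [word_cons]
        exact mul_mem (hF i.1 i.2).1 (ih hl')
  set r : ℝ := 1 / (2 * (K + 1)) with hr
  have hr0 : 0 < r := by positivity
  obtain ⟨C, hC⟩ := growthOn_top_of_quasinilpotent (m := (Subtype.val : F → E →L[ℂ] E))
    (fun i => (hF i.1 i.2).2)
    (fun l hl => hasSuperexponentialDecay_of_spectralRadius_eq_zero (hquasi _ (hword l hl))) hr0
  refine not_orbitBall_halving (m := (Subtype.val : F → E →L[ℂ] E)) (r := r) (t := C * ‖x₀‖) hx₀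
    (fun l => (hC l x₀ trivial).trans_eq (by ring)) fun s hs y hy hys => ?_
  obtain ⟨h, hh, hhy⟩ := hret k (by simpa using hδ.le) y hy
  refine ⟨_, hhy, orbitBall_mono hr0.le ?_
    (hFK (h * k) (Finset.mem_image_of_mem _ hh) r s hr0.le hs y hys)⟩
  have : K * r ≤ 1 / 2 := by
    rw [hr, mul_one_div, div_le_div_iff₀ (by positivity) (by norm_num)]
    linarith
  nlinarith

end CompactCase

/-! ### Nil algebras -/

section NilCase

variable {E : Type*} [NormedAddCommGroup E] [NormedSpace ℂ E]

/-- A quasinilpotent polynomially compact operator has a compact power, as `p(T) = T ^ n * q(T)`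
with `q(0) ≠ 0`, so that `q(T)` is invertible. -/
lemma exists_isCompactOperator_pow [CompleteSpace E] [Nontrivial E] {T : E →L[ℂ] E}
    (hq : IsQuasinilpotent T) (hc : IsPolynomiallyCompact T) :
    ∃ n : ℕ, IsCompactOperator (T ^ (n + 1) : E →L[ℂ] E) := by
  obtain ⟨p, hp0, hp⟩ := hc
  obtain ⟨q, hpq, hdvd⟩ := Polynomial.exists_eq_pow_rootMultiplicity_mul_and_not_dvd p hp0 0
  set n := p.rootMultiplicity 0
  rw [Polynomial.dvd_iff_isRoot, Polynomial.IsRoot.def] at hdvd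
  have hunit : IsUnit (Polynomial.aeval T q) := by
    by_contra hnu
    have h0 : (0 : ℂ) ∈ spectrum ℂ (Polynomial.aeval T q) := spectrum.zero_mem ℂ hnu
    rw [spectrum.map_polynomial_aeval] at h0
    obtain ⟨z, hz, hqz⟩ := h0
    have hz0 : (‖z‖₊ : ENNReal) ≤ 0 := hq ▸ le_iSup₂ (f := fun (k : ℂ) (_ : k ∈ spectrum ℂ T) =>
      (‖k‖₊ : ENNReal)) z hz
    have : z = 0 := by simpa using hz0
    exact hdvd (this ▸ hqz)
  obtain ⟨v, hv⟩ := hunit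
  refine ⟨n, ?_⟩
  have e : T ^ (n + 1) = T * Polynomial.aeval T p * (v⁻¹ : (E →L[ℂ] E)ˣ) := by
    rw [hpq]
    simp only [map_zero, sub_zero, map_mul, map_pow, Polynomial.aeval_X]
    rw [← hv, mul_assoc, mul_assoc, Units.mul_inv, mul_one, pow_succ']
  rw [e]
  exact (hp.clm_comp T).comp_clm _

/-- In a non-zero closed algebra of nilpotent operators some `u ≠ 0` satisfies `u * x * u = 0` for
all `x`. By Baire's theorem `(a + t x) ^ n = 0` on an open set for some `n`; for the least such `n`
there is `a` with `u = a ^ (n - 1) ≠ 0`, and the identity results from differentiation at `t = 0`. -/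
lemma exists_sandwich_eq_zero [CompleteSpace E] [Nontrivial E]
    (A : NonUnitalSubalgebra ℂ (E →L[ℂ] E)) (hA : ∃ x ∈ A, x ≠ 0)
    (hclosed : IsClosed (A : Set (E →L[ℂ] E))) (hnil : ∀ T ∈ A, ∃ n : ℕ, T ^ n = 0) :
    ∃ u ∈ A, u ≠ 0 ∧ u * u = 0 ∧ ∀ x ∈ A, u * x * u = 0 := by
  classical
  have : TopologicalSpace.IsCompletelyMetrizableSpace A :=
    hclosed.isClosedEmbedding_subtypeVal.IsCompletelyMetrizableSpace
  have : BaireSpace A := BaireSpace.of_completelyPseudoMetrizable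
  set f : ℕ → Set A := fun n => {T | (T : E →L[ℂ] E) ^ n = 0} with hf
  have hint : ∃ n, (interior (f n)).Nonempty := nonempty_interior_of_iUnion_of_closed
    (fun n => isClosed_eq (by fun_prop) continuous_const) (Set.eq_univ_of_forall fun T => by
      obtain ⟨n, hn⟩ := hnil T.1 T.2
      exact Set.mem_iUnion.2 ⟨n, hn⟩)
  obtain ⟨k, hk⟩ : ∃ k, Nat.find hint = k + 1 := by
    refine Nat.exists_eq_succ_of_ne_zero fun h => ?_
    obtain ⟨T, hT⟩ := h ▸ Nat.find_spec hint
    have : (T : E →L[ℂ] E) ^ 0 = 0 := (interior_subset hT : T ∈ f 0)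
    simp at this
  have hk1 : (interior (f (k + 1))).Nonempty := hk ▸ Nat.find_spec hint
  have hk0 : ¬ (interior (f k)).Nonempty := Nat.find_min hint (by omega)
  obtain ⟨a, ha, hak⟩ : ∃ a ∈ interior (f (k + 1)), (a : E →L[ℂ] E) ^ k ≠ 0 := by
    by_contra! h
    exact hk0 (hk1.mono (interior_maximal h isOpen_interior))
  have hak1 : (a : E →L[ℂ] E) ^ (k + 1) = 0 :=
    (interior_subset ha : a ∈ f (k + 1))
  have hvanish : ∀ j, k < j → (a : E →L[ℂ] E) ^ j = 0 := fun j hj => by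
    rw [← Nat.add_sub_cancel' hj, pow_add, hak1, zero_mul]
  have key : ∀ x ∈ A, (a : E →L[ℂ] E) ^ k * x * (a : E →L[ℂ] E) ^ k = 0 := by
    intro x hx
    have hline : HasFDerivAt (fun t : ℂ => (a : E →L[ℂ] E) + t • x)
        ((ContinuousLinearMap.id ℂ ℂ).smulRight x) 0 :=
      ((hasFDerivAt_id (0 : ℂ)).smul_const x).const_add _
    have hder := hline.pow' (k + 1)
    have hzero : ((fun t : ℂ => (a : E →L[ℂ] E) + t • x) ^ (k + 1)) =ᶠ[𝓝 0] fun _ => 0 := by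
      have hcont : Tendsto (fun t : ℂ => a + t • (⟨x, hx⟩ : A)) (𝓝 0) (𝓝 a) :=
        Continuous.tendsto' (by fun_prop) _ _ (by simp)
      filter_upwards [hcont (isOpen_interior.mem_nhds ha)] with t ht
      exact (interior_subset ht : a + t • (⟨x, hx⟩ : A) ∈ f (k + 1))
    have h0 := hder.unique ((hasFDerivAt_const (0 : E →L[ℂ] E) (0 : ℂ)).congr_of_eventuallyEq hzero)
    have h1 := congrArg (fun L : ℂ →L[ℂ] (E →L[ℂ] E) => (a : E →L[ℂ] E) ^ k * L 1) h0
    simp only [zero_smul, add_zero, sum_apply, smul_apply, ContinuousLinearMap.smulRight_apply,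
      ContinuousLinearMap.id_apply, one_smul, zero_apply, mul_zero, Finset.mul_sum, smul_eq_mul,
      MulOpposite.smul_eq_mul_unop, MulOpposite.unop_op, Nat.pred_succ] at h1
    rw [Finset.sum_eq_single k] at h1
    · simpa [mul_assoc] using h1
    · intro i hi hik
      rw [Finset.mem_range] at hi
      rw [← mul_assoc, ← mul_assoc, ← pow_add, hvanish _ (by omega), zero_mul, zero_mul]
    · simp
  rcases Nat.eq_zero_or_pos k with rfl | hkpos
  · obtain ⟨x, hx, hx0⟩ := hA
    exact absurd (by simpa using key x hx) hx0
  · refine ⟨(a : E →L[ℂ] E) ^ k, ?_, hak, ?_, key⟩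
    · obtain ⟨j, rfl⟩ := Nat.exists_eq_succ_of_ne_zero hkpos.ne'
      clear hak hak1 key hvanish hk hk0 hk1 ha hkpos
      induction j with
      | zero => simp
      | succ j ih => rw [pow_succ]; exact mul_mem ih a.2
    · rw [← pow_add]
      exact hvanish _ (by omega)

/-- If `u ≠ 0` in the algebra `A` satisfies `u * u = 0` and `u * x * u = 0` for all `x ∈ A`, then
`u` vanishes on the orbit of `u y` under the hyperalgebra. -/
lemma isReducible_of_sandwich_eq_zero (A : NonUnitalSubalgebra ℂ (E →L[ℂ] E)) {u : E →L[ℂ] E}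
    (huA : u ∈ A) (hu0 : u ≠ 0) (huu : u * u = 0) (hu : ∀ x ∈ A, u * x * u = 0) :
    IsReducible (hyperalgebra (A : Set (E →L[ℂ] E)) : Set (E →L[ℂ] E)) := by
  -- The operators `g` with `u * g = 0` and `u * x * g = 0` for all `x ∈ A`.
  let J : Submodule ℂ (E →L[ℂ] E) :=
    { carrier := {g | u * g = 0 ∧ ∀ x ∈ A, u * x * g = 0}
      add_mem' := fun {g g'} hg hg' => ⟨by rw [mul_add, hg.1, hg'.1, add_zero],
        fun x hx => by rw [mul_add, hg.2 x hx, hg'.2 x hx, add_zero]⟩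
      zero_mem' := by simp
      smul_mem' := fun c g hg => ⟨by rw [mul_smul_comm, hg.1, smul_zero],
        fun x hx => by rw [mul_smul_comm, hg.2 x hx, smul_zero]⟩ }
  have hJ : ∀ T ∈ (A : Set (E →L[ℂ] E)) ∪ Set.centralizer (A : Set (E →L[ℂ] E)), ∀ g ∈ J,
      T * g ∈ J := by
    rintro T (hT | hT) g ⟨hg, hg'⟩
    · refine ⟨by rw [← mul_assoc]; exact hg' T hT, fun x hx => ?_⟩
      rw [← mul_assoc, mul_assoc u x T]
      exact hg' _ (mul_mem hx hT)
    · refine ⟨by rw [← mul_assoc, hT u huA, mul_assoc, hg, mul_zero], fun x hx => ?_⟩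
      rw [← mul_assoc, hT (u * x) (mul_mem huA hx), mul_assoc, hg' x hx, mul_zero]
  obtain ⟨y, hy⟩ : ∃ y, u y ≠ 0 := by
    by_contra! h
    exact hu0 (ContinuousLinearMap.ext h)
  refine isReducible_of_not_dense hy fun hd => hy ?_
  have hker : closure {z | ∃ h ∈ (hyperalgebra (A : Set (E →L[ℂ] E)) : Set (E →L[ℂ] E)),
      h (u y) = z} ⊆ {z | u z = 0} := by
    refine closure_minimal ?_ (isClosed_eq u.continuous continuous_const)
    rintro _ ⟨h, hh, rfl⟩
    exact congrArg (fun T : E →L[ℂ] E => T y) (hyperalgebra_mul_mem hJ hh u ⟨huu, hu⟩).1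
  exact hker (hd y)

end NilCase

end HyperinvariantSubspace

theorem theorem3p3 {E : Type*} [NormedAddCommGroup E] [NormedSpace ℂ E] [CompleteSpace E]
    (A : NonUnitalSubalgebra ℂ (E →L[ℂ] E)) (hA : A ≠ ⊥)
    (hclosed : IsClosed (A : Set (E →L[ℂ] E)))
    (hquasi : ∀ T ∈ A, HyperinvariantSubspace.IsQuasinilpotent T)
    (hcompact : ∀ T ∈ A, HyperinvariantSubspace.IsPolynomiallyCompact T) :
    (∃ M : Submodule ℂ E, HyperinvariantSubspace.IsNontrivialSubspace M ∧
      HyperinvariantSubspace.IsHyperinvariantSubspace (A : Set (E →L[ℂ] E)) M) ∧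
    HyperinvariantSubspace.IsReducible
      (HyperinvariantSubspace.hyperalgebra (A : Set (E →L[ℂ] E)) : Set (E →L[ℂ] E)) := by
  have hred : HyperinvariantSubspace.IsReducible
      (HyperinvariantSubspace.hyperalgebra (A : Set (E →L[ℂ] E)) : Set (E →L[ℂ] E)) := by
    by_cases h : ∃ k ∈ A, IsCompactOperator k ∧ k ≠ 0
    · obtain ⟨k, hkA, hk, hk0⟩ := h
      exact HyperinvariantSubspace.isReducible_of_isCompactOperator A hquasi hkA hk hk0
    · push Not at h
      have hA' : ∃ x ∈ A, x ≠ 0 := by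
        by_contra! h0
        exact hA (SetLike.ext fun x =>
          ⟨fun hx => h0 x hx ▸ zero_mem _, fun hx => NonUnitalAlgebra.mem_bot.1 hx ▸ zero_mem _⟩)
      have : Nontrivial E := by
        obtain ⟨x, -, hx0⟩ := hA'
        by_contra hE
        rw [not_nontrivial_iff_subsingleton] at hE
        exact hx0 (Subsingleton.elim x 0)
      obtain ⟨u, huA, hu0, huu, hu⟩ :=
        HyperinvariantSubspace.exists_sandwich_eq_zero A hA' hclosed fun T hT => by
          obtain ⟨n, hn⟩ := HyperinvariantSubspace.exists_isCompactOperator_pow (hquasi T hT)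
            (hcompact T hT)
          have hmem : ∀ j : ℕ, T ^ (j + 1) ∈ A := fun j => by
            induction j with
            | zero => simpa using hT
            | succ j ih => rw [pow_succ]; exact mul_mem ih hT
          exact ⟨n + 1, h _ (hmem n) hn⟩
      exact HyperinvariantSubspace.isReducible_of_sandwich_eq_zero A huA hu0 huu hu
  refine ⟨?_, hred⟩
  obtain ⟨M, hM, hMc, hMi⟩ := hred
  have hsub := HyperinvariantSubspace.subset_hyperalgebra (A : Set (E →L[ℂ] E))
  exact ⟨M, hM, ⟨hMc, fun T hT => hMi T (hsub (Or.inl hT))⟩,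
    ⟨hMc, fun T hT => hMi T (hsub (Or.inr hT))⟩⟩
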